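/- Let $k\in\{1,2,\dots,\infty\}$ and let $(\mathcal M^4,g)$ be a connected, time-oriented Lorentzian manifold with $C^k$ metric $g$ of signature $(-,+,+,+)$ ($\mathcal M$ smooth, Hausdorff, second countable). Suppose that $(\mathcal M,g)$ is \emph{spherically symmetric} with (possibly empty) center $\Gamma$ in the following sense. (a) There are a set $\mathcal Q\subset\mathbb R^2_{u,v}$ and a subset $\Gamma_{\mathcal Q}\subset\mathcal Q$ such that $\mathring{\mathcal Q}=\mathcal Q\setminus\Gamma_{\mathcal Q}$ is open in $\mathbb R^2$ and, near each point of $\Gamma_{\mathcal Q}$, one has $\mathcal Q=\{v\ge h(u)\}$ and $\Gamma_{\mathcal Q}=\{v=h(u)\}$ for some $C^{k+1}$ function $h$ with $h'>0$ (so $\mathcal Q$ is a surface with timelike boundary $\Gamma_{\mathcal Q}$). There is a continuous surjection $\Phi:\mathcal Q\times S^2\to\mathcal M$, with continuous projection $(u,v):\mathcal M\to\mathcal Q$, $(u,v)\circ\Phi=\mathrm{pr}_{\mathcal Q}$, such that $\Phi$ collapses each sphere over $\Gamma_{\mathcal Q}$ to a point, $\Gamma=\Phi(\Gamma_{\mathcal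 Q}\times S^2)$, and $\Phi$ restricts to a $C^{k+1}$ diffeomorphism $\mathring{\mathcal Q}\times S^2\cong\mathcal M\setminus\Gamma$. (b) There are $C^k$ functions $\Omega^2>0$ and $r\ge 0$ on $\mathcal Q$, with $r>0$ on $\mathring{\mathcal Q}$ and $r=0$ on $\Gamma_{\mathcal Q}$, such that on $\mathcal M\setminus\Gamma$ $$g=-\Omega^2\,du\,dv+r^2 g_{S^2},$$ where $du\,dv=\tfrac12(du\otimes dv+dv\otimes du)$, $g_{S^2}$ is the round unit metric, and $\partial_u,\partial_v$ are future-directed. Along $\Gamma_{\mathcal Q}$ one has $\partial_v r>0$ and $\partial_u r<0$. (c) The action of $SO(3)$ on $\mathcal M$ that rotates the $S^2$ factor on $\mathcal M\setminus\Gamma$ and fixes $\Gamma$ pointwise is by $C^{k+1}$ isometries, and $\Gamma$, if nonempty, consists of one timelike geodesic. A \emph{null hypersurface} is a 3-dimensional submanifold $H$ of $\mathcal M$ with a future-directed null normal vector field $L$ whose integral curves are reparametrizations of null geodesics; its \emph{null expansion} with respect to $L$ is $\theta^L=g(\nabla_{e_1}L,e_1)+g(\nabla_{e_2}L,e_2)$,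 where $\nabla$ is the Levi-Civita connection and $e_1,e_2$ is any orthonormal pair of spacelike vectors tangent to $H$; its sign does not depend on the choice of $L$. A \emph{trapped surface} is a nonempty compact embedded spacelike $C^2$ surface $S\subset\mathcal M$ without boundary such that near each of its points $S$ is the intersection of two transversal null hypersurfaces (of class $C^2$, with $C^1$ null normals), both of which have negative future null expansion $\theta^L<0$ along $S$. Then no trapped surface is contained in $$A=\{p\in\mathcal M:\partial_u r\ge 0\},$$ and no trapped surface is contained in $$B=\{p\in\mathcal M:\partial_v r\ge 0\}.$$ -/

import Mathlib

open Set Topology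
open scoped Manifold ContDiff

noncomputable section

/-- Euclidean 3-space. -/
abbrev E3 : Type := EuclideanSpace ℝ (Fin 3)

/-- Euclidean 4-space, the model space of spacetimes. -/
abbrev E4 : Type := EuclideanSpace ℝ (Fin 4)

/-- The unit sphere of Euclidean 3-space, with Mathlib's smooth structure. -/
abbrev S2 : Type := Metric.sphere (0 : E3) 1

/-! ### Lorentzian metrics and the Levi-Civita connection -/

section Lorentz

variable {M : Type*} [TopologicalSpace M] [ChartedSpace E4 M] [IsManifold (𝓡 4) ∞ M]

/-- The differential `df(X)` of a real function on `M`. -/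
def dReal {x : M} (f : M → ℝ) (X : TangentSpace (𝓡 4) x) : ℝ := mfderiv (𝓡 4) 𝓘(ℝ, ℝ) f x X

/-- The differential of an `S²`-valued map on `M`, with values in the ambient Euclidean space. -/
def dSphere {x : M} (n : M → S2) (X : TangentSpace (𝓡 4) x) : E3 :=
  mfderiv (𝓡 4) 𝓘(ℝ, E3) (fun q ↦ (n q : E3)) x X

/-- A Lorentzian metric of class `C^k`, of signature `(-,+,+,+)`, on a smooth 4-manifold. -/
structure LorentzMetric (k : ℕ∞) (M : Type*) [TopologicalSpace M] [ChartedSpace E4 M]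
    [IsManifold (𝓡 4) ∞ M] where
  /-- the scalar product on each tangent space -/
  val (x : M) : TangentSpace (𝓡 4) x →L[ℝ] TangentSpace (𝓡 4) x →L[ℝ] ℝ
  symm (x : M) (X Y : TangentSpace (𝓡 4) x) : val x X Y = val x Y X
  /-- there is a timelike vector whose orthogonal complement is positive definite -/
  lorentzian (x : M) : ∃ t : TangentSpace (𝓡 4) x, val x t t < 0 ∧
    ∀ X : TangentSpace (𝓡 4) x, val x t X = 0 → X ≠ 0 → 0 < val x X X
  contMDiff : ContMDiff (𝓡 4) ((𝓡 4).prod 𝓘(ℝ, E4 →L[ℝ] E4 →L[ℝ] ℝ)) k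
    (fun x ↦ Bundle.TotalSpace.mk' (E4 →L[ℝ] E4 →L[ℝ] ℝ)
      (E := fun x : M ↦ TangentSpace (𝓡 4) x →L[ℝ] TangentSpace (𝓡 4) x →L[ℝ] ℝ) x (val x))

/-- A time orientation: a continuous timelike vector field. -/
structure TimeOrientation {k : ℕ∞} (g : LorentzMetric k M) where
  /-- the timelike vector field -/
  vec (x : M) : TangentSpace (𝓡 4) x
  continuous : Continuous (fun x ↦ (⟨x, vec x⟩ : TangentBundle (𝓡 4) M))
  timelike (x : M) : g.val x (vec x) (vec x) < 0

/-- A nonzero causal vector is future-directed if it lies in the same half of the cone as the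
time orientation. -/
def TimeOrientation.IsFuture {k : ℕ∞} {g : LorentzMetric k M} (τ : TimeOrientation g) {x : M}
    (X : TangentSpace (𝓡 4) x) : Prop :=
  X ≠ 0 ∧ g.val x X X ≤ 0 ∧ g.val x (τ.vec x) X < 0

namespace LorentzMetric

variable {k : ℕ∞} (g : LorentzMetric k M)

/-- The components `g_y(a, b)` of the metric in the preferred chart at `x`, as a function of the
coordinate `y`. -/
def coord (x : M) (a b : E4) (y : E4) : ℝ :=
  g.val ((extChartAt (𝓡 4) x).symm y)
    (mfderiv 𝓘(ℝ, E4) (𝓡 4) (extChartAt (𝓡 4) x).symm y a)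
    (mfderiv 𝓘(ℝ, E4) (𝓡 4) (extChartAt (𝓡 4) x).symm y b)

/-- The Christoffel symbols of the first kind at `x`, in the preferred chart at `x`:
`Γ(a, b; c) = (∂_a g(b, c) + ∂_b g(a, c) - ∂_c g(a, b)) / 2`. -/
def christoffel (x : M) (a b c : E4) : ℝ :=
  (fderiv ℝ (g.coord x b c) (extChartAt (𝓡 4) x x) a
    + fderiv ℝ (g.coord x a c) (extChartAt (𝓡 4) x x) b
    - fderiv ℝ (g.coord x a b) (extChartAt (𝓡 4) x x) c) / 2

/-- `g(∇_X L, Y)` at `x`, where `∇` is the Levi-Civita connection, `L` a vector field, and `X`, `Y`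
are tangent vectors at `x`. It is computed in the preferred chart at `x`, whose differential
identifies the tangent space at `x` with the model space by the identity map. -/
def covDeriv (L : ∀ x : M, TangentSpace (𝓡 4) x) (x : M) (X Y : TangentSpace (𝓡 4) x) : ℝ :=
  g.val x
    (fderiv ℝ (fun y : E4 ↦ (mfderiv (𝓡 4) 𝓘(ℝ, E4) (extChartAt (𝓡 4) x)
      ((extChartAt (𝓡 4) x).symm y) (L ((extChartAt (𝓡 4) x).symm y)) : E4))
      (extChartAt (𝓡 4) x x) (X : E4) : E4) Y
  + g.christoffel x X (L x) Y

/-- The (affine) geodesic equation `∇_{γ'} γ' = 0` at the parameter `t`, written in the preferred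
chart at `γ t` and paired with an arbitrary vector `Y`. -/
def IsGeodesicAt (γ : ℝ → M) (t : ℝ) : Prop :=
  ∀ Y : E4,
    g.val (γ t) (deriv (deriv (fun s ↦ (extChartAt (𝓡 4) (γ t) (γ s) : E4))) t : E4) Y
      + g.christoffel (γ t) (deriv (fun s ↦ (extChartAt (𝓡 4) (γ t) (γ s) : E4)) t)
        (deriv (fun s ↦ (extChartAt (𝓡 4) (γ t) (γ s) : E4)) t) Y = 0

end LorentzMetric

/-! ### Null hypersurfaces and trapped surfaces -/

/-- A null hypersurface in the open set `U`: a regular level set `{f = 0}` in `U`, with a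
future-directed null normal `L` (a null generator, extended to a vector field on `U`) whose
integral curves on the hypersurface are reparametrizations of geodesics, i.e. `∇_L L` is
proportional to `L`. -/
structure NullHypersurface {k : ℕ∞} (g : LorentzMetric k M) (τ : TimeOrientation g)
    (U : Set M) where
  /-- the defining function -/
  f : M → ℝ
  /-- the null generator -/
  L (x : M) : TangentSpace (𝓡 4) x
  contMDiffOn_f : ContMDiffOn (𝓡 4) 𝓘(ℝ, ℝ) 2 f U
  contMDiffOn_L : ContMDiffOn (𝓡 4) (𝓡 4).tangent 1
    (fun x ↦ (⟨x, L x⟩ : TangentBundle (𝓡 4) M)) U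
  regular : ∀ x ∈ U, f x = 0 → mfderiv (𝓡 4) 𝓘(ℝ, ℝ) f x ≠ 0
  normal : ∀ x ∈ U, f x = 0 → ∀ X : TangentSpace (𝓡 4) x,
    dReal f X = 0 → g.val x (L x) X = 0
  null : ∀ x ∈ U, f x = 0 → g.val x (L x) (L x) = 0
  future : ∀ x ∈ U, f x = 0 → τ.IsFuture (L x)
  geodesic : ∀ x ∈ U, f x = 0 → ∃ κ : ℝ, ∀ Y : TangentSpace (𝓡 4) x,
    g.covDeriv L x (L x) Y = κ * g.val x (L x) Y

namespace NullHypersurface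

variable {k : ℕ∞} {g : LorentzMetric k M} {τ : TimeOrientation g} {U : Set M}

/-- The points of the hypersurface. -/
def carrier (H : NullHypersurface g τ U) : Set M := {x | x ∈ U ∧ H.f x = 0}

/-- The second fundamental form `B^L(X, Y) = g(∇_X L, Y)`. -/
def secondFF (H : NullHypersurface g τ U) (x : M) (X Y : TangentSpace (𝓡 4) x) : ℝ :=
  g.covDeriv H.L x X Y

/-- The null expansion `θ^L = B^L(e₁, e₁) + B^L(e₂, e₂)` at `x` is negative. It does not depend on
the orthonormal pair `e₁`, `e₂` of vectors tangent to the hypersurface. -/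
def NegativeExpansionAt (H : NullHypersurface g τ U) (x : M) : Prop :=
  ∀ e₁ e₂ : TangentSpace (𝓡 4) x,
    dReal H.f e₁ = 0 → dReal H.f e₂ = 0 →
    g.val x e₁ e₁ = 1 → g.val x e₂ e₂ = 1 → g.val x e₁ e₂ = 0 →
    H.secondFF x e₁ e₁ + H.secondFF x e₂ e₂ < 0

end NullHypersurface

/-- `ι : N → M`, with `N` a nonempty compact surface without boundary, is an embedded closed
spacelike surface of class `C²` that is (strictly) trapped: locally it is the intersection of two
transversal null hypersurfaces, and both have negative future null expansion along it.
(Spacelikeness makes `ι` an immersion.) -/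
structure IsTrappedSurface {k : ℕ∞} (g : LorentzMetric k M) (τ : TimeOrientation g)
    {N : Type*} [TopologicalSpace N] [ChartedSpace (EuclideanSpace ℝ (Fin 2)) N]
    [IsManifold (𝓡 2) 2 N] (ι : N → M) : Prop where
  compact : CompactSpace N
  nonempty : Nonempty N
  contMDiff : ContMDiff (𝓡 2) (𝓡 4) 2 ι
  isEmbedding : IsEmbedding ι
  spacelike : ∀ (q : N) (X : TangentSpace (𝓡 2) q), X ≠ 0 →
    0 < g.val (ι q) (mfderiv (𝓡 2) (𝓡 4) ι q X) (mfderiv (𝓡 2) (𝓡 4) ι q X)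
  trapped : ∀ p ∈ range ι, ∃ U : Set M, IsOpen U ∧ p ∈ U ∧
    ∃ H₁ H₂ : NullHypersurface g τ U,
      range ι ∩ U = H₁.carrier ∩ H₂.carrier ∧
      ∀ x ∈ range ι ∩ U, LinearIndependent ℝ ![H₁.L x, H₂.L x] ∧
        H₁.NegativeExpansionAt x ∧ H₂.NegativeExpansionAt x

/-! ### Spherical symmetry -/

/-- The data exhibiting the time-oriented Lorentzian manifold `(M, g)` as spherically symmetric,
with (possibly empty) center, in global double null coordinates `(u, v)`. The quotient `Q` by the
action of `SO(3)` is identified with its image in the `(u, v)`-plane. -/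
structure SphericallySymmetric {k : ℕ∞} (g : LorentzMetric k M) (τ : TimeOrientation g) where
  /-- the null coordinates, as functions on `M` -/
  u : M → ℝ
  v : M → ℝ
  /-- the `S²` component of the splitting (irrelevant at the center) -/
  angle : M → S2
  /-- the quotient, and its boundary, the projection of the center -/
  Q : Set (ℝ × ℝ)
  axis : Set (ℝ × ℝ)
  /-- the map `Q × S² → M`, inverse to the splitting off the center and collapsing each sphere
  over the boundary to a point -/
  point : (ℝ × ℝ) × S2 → M
  /-- area radius and lapse -/
  r : ℝ × ℝ → ℝ
  OmegaSq : ℝ × ℝ → ℝ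
  /-- `Q` is a surface with boundary `axis`, and the boundary is a timelike curve, with `Q` on its
  outer side (which is forced by the signs of `r`, `∂_v r` below) -/
  axis_subset : axis ⊆ Q
  isOpen_interior : IsOpen (Q \ axis)
  boundary : ∀ z ∈ axis, ∃ V ∈ 𝓝 z, ∃ h : ℝ → ℝ,
    ContDiffAt ℝ (k + 1) h z.1 ∧ 0 < deriv h z.1 ∧
    ∀ w ∈ V, (w ∈ Q ↔ h w.1 ≤ w.2) ∧ (w ∈ axis ↔ w.2 = h w.1)
  /-- the functions on `Q` -/
  contDiffOn_r : ContDiffOn ℝ k r Q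
  contDiffOn_OmegaSq : ContDiffOn ℝ k OmegaSq Q
  OmegaSq_pos : ∀ z ∈ Q, 0 < OmegaSq z
  r_pos : ∀ z ∈ Q \ axis, 0 < r z
  r_axis : ∀ z ∈ axis, r z = 0
  /-- along the center, `u` is ingoing and `v` is outgoing -/
  du_r_axis : ∀ z ∈ axis, fderivWithin ℝ r Q z (1, 0) < 0
  dv_r_axis : ∀ z ∈ axis, 0 < fderivWithin ℝ r Q z (0, 1)
  /-- `M` is `Q × S²` with the spheres over the boundary collapsed to points -/
  continuous_u : Continuous u
  continuous_v : Continuous v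
  mem_Q : ∀ p : M, (u p, v p) ∈ Q
  continuousOn_point : ContinuousOn point (Q ×ˢ univ)
  coord_point : ∀ z ∈ Q, ∀ θ : S2, (u (point (z, θ)), v (point (z, θ))) = z
  point_coord : ∀ p : M, point ((u p, v p), angle p) = p
  angle_point : ∀ z ∈ Q \ axis, ∀ θ : S2, angle (point (z, θ)) = θ
  point_axis : ∀ z ∈ axis, ∀ θ θ' : S2, point (z, θ) = point (z, θ')
  /-- off the center, the splitting is a diffeomorphism onto `(Q \ axis) × S²` -/
  contMDiffOn_u : ContMDiffOn (𝓡 4) 𝓘(ℝ, ℝ) (k + 1) u {p | (u p, v p) ∉ axis}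
  contMDiffOn_v : ContMDiffOn (𝓡 4) 𝓘(ℝ, ℝ) (k + 1) v {p | (u p, v p) ∉ axis}
  contMDiffOn_angle : ContMDiffOn (𝓡 4) (𝓡 2) (k + 1) angle {p | (u p, v p) ∉ axis}
  contMDiffOn_point : ContMDiffOn (𝓘(ℝ, ℝ × ℝ).prod (𝓡 2)) (𝓡 4) (k + 1) point
    ((Q \ axis) ×ˢ univ)
  /-- off the center, `g = - Ω² du dv + r² g_{S²}`, where `du dv` is the symmetric product
  `(du ⊗ dv + dv ⊗ du) / 2` and `g_{S²}` is induced by the Euclidean inner product -/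
  metric : ∀ p : M, (u p, v p) ∉ axis → ∀ X Y : TangentSpace (𝓡 4) p,
    g.val p X Y =
      - OmegaSq (u p, v p) / 2 * (dReal u X * dReal v Y + dReal v X * dReal u Y)
      + r (u p, v p) ^ 2 * inner ℝ (dSphere angle X) (dSphere angle Y)
  /-- off the center, the coordinate vector fields `∂_u` and `∂_v` are future-directed -/
  future_u : ∀ p : M, (u p, v p) ∉ axis → ∀ X : TangentSpace (𝓡 4) p,
    dReal u X = 1 → dReal v X = 0 → dSphere angle X = 0 → τ.IsFuture X
  future_v : ∀ p : M, (u p, v p) ∉ axis → ∀ X : TangentSpace (𝓡 4) p,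
    dReal u X = 0 → dReal v X = 1 → dSphere angle X = 0 → τ.IsFuture X
  /-- `SO(3)` acts by isometries on `M`: by rotations of the `S²` factor off the center, and
  fixing the center -/
  isometric : ∀ R : E3 ≃ₗᵢ[ℝ] E3, LinearMap.det (R.toLinearEquiv : E3 →ₗ[ℝ] E3) = 1 →
    ∃ F : M → M, ContMDiff (𝓡 4) (𝓡 4) (k + 1) F ∧
      (∀ p, (u p, v p) ∉ axis →
        u (F p) = u p ∧ v (F p) = v p ∧ (angle (F p) : E3) = R (angle p : E3)) ∧
      (∀ p, (u p, v p) ∈ axis → F p = p) ∧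
      ∀ (p : M) (X Y : TangentSpace (𝓡 4) p),
        g.val (F p) (mfderiv (𝓡 4) (𝓡 4) F p X) (mfderiv (𝓡 4) (𝓡 4) F p Y) = g.val p X Y
  /-- the center, if nonempty, consists of one timelike geodesic -/
  center_geodesic : ∃ (J : Set ℝ) (γ : ℝ → M), IsOpen J ∧ J.OrdConnected ∧
    ContMDiffOn 𝓘(ℝ, ℝ) (𝓡 4) (k + 1) γ J ∧ InjOn γ J ∧
    γ '' J = {p | (u p, v p) ∈ axis} ∧
    ∀ t ∈ J, g.IsGeodesicAt γ t ∧
      g.val (γ t) (mfderiv 𝓘(ℝ, ℝ) (𝓡 4) γ t (1 : ℝ))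
        (mfderiv 𝓘(ℝ, ℝ) (𝓡 4) γ t (1 : ℝ)) < 0

namespace SphericallySymmetric

variable {k : ℕ∞} {g : LorentzMetric k M} {τ : TimeOrientation g}

/-- The function `∂_u r` on `Q` (one-sided at the boundary). -/
def du_r (D : SphericallySymmetric g τ) (z : ℝ × ℝ) : ℝ := fderivWithin ℝ D.r D.Q z (1, 0)

/-- The function `∂_v r` on `Q` (one-sided at the boundary). -/
def dv_r (D : SphericallySymmetric g τ) (z : ℝ × ℝ) : ℝ := fderivWithin ℝ D.r D.Q z (0, 1)

end SphericallySymmetric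

end Lorentz

end

/-!
On a compact surface the null coordinates `u` and `v` attain their minima, and the theorem compares
the surface at such a point with the level set of the coordinate, a null cone of the spherically
symmetric spacetime.

Off the center, let `u` restricted to the surface be minimal at `q`. Then `∂_v`, which is the null
normal of the level set of `u`, is also normal to the surface, hence a positive multiple of one of
the two null normals `L` of the surface (`null_normal_proportional`). The null second fundamental
form of the surface differs from that of the level set by the Hessian of `u` along the surface:
for a curve `c` in the surface with velocity `e` at `q`, and `L = ∂_v`,
`g(∇_e L, e) = r ∂_v r |dn(e)|² + (Ω² / 2) (u ∘ c)''`, where `n` is the angular coordinate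
(`doubleNullForm_secondFF`). Where `∂_v r ≥ 0` both terms are nonnegative at a minimum, so the
expansion in the direction `L` is not negative (`IsTrappedSurface.not_isLocalMin`). A minimum of `v`
is treated in the same way with the roles of `u` and `v` exchanged (`DoubleNullAt.swap`).

At the center `∂_u r < 0`, so only the minimum of `u` has to be considered there. Near a point `p`
of the center, the set `{u ≥ u(p)}` lies in the causal future of `p`: its points are reached by first
following `∂_v` and then `∂_u` (`SphericallySymmetric.eventually_le_of_mem_axis`). A linear function
`-g_p(W, ·)` of the coordinates at `p`, with `W` timelike and future-directed, increases along such
paths, so it would have a minimum on the surface at `p` and `W` would be orthogonal to the surface.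
A spacelike plane is not orthogonal to all such `W`
(`SphericallySymmetric.not_isLocalMin_of_mem_axis`).
-/

/-! ### Lorentzian scalar products -/

section LorentzianAlgebra

variable {V : Type*} [AddCommGroup V] [Module ℝ V] [TopologicalSpace V]
  {B : V →L[ℝ] V →L[ℝ] ℝ}

/-- If the orthogonal complement of one timelike vector is positive definite, so is that of every
timelike vector. -/
theorem pos_of_orthogonal_timelike (hs : ∀ X Y, B X Y = B Y X)
    (hB : ∃ t, B t t < 0 ∧ ∀ X, B t X = 0 → X ≠ 0 → 0 < B X X)
    {W X : V} (hW : B W W < 0) (hWX : B W X = 0) (hX : X ≠ 0) : 0 < B X X := by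
  obtain ⟨t, -, ht⟩ := hB
  have htW : B t W ≠ 0 := by
    intro h
    by_cases hW0 : W = 0
    · simp [hW0] at hW
    · exact absurd (ht W h hW0) (by linarith)
  have hw : 0 < B (B t W • X - B t X • W) (B t W • X - B t X • W) := by
    refine ht _ (by simp; ring) fun h ↦ ?_
    have h1 : B W (B t W • X - B t X • W) = 0 := by rw [h]; simp
    simp only [map_sub, map_smul, smul_eq_mul, hWX] at h1
    have h2 : B t X = 0 := by
      rcases mul_eq_zero.1 (show B t X * B W W = 0 by linarith) with h2 | h2
      · exact h2
      · exact absurd h2 hW.ne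
    rw [h2, zero_smul, sub_zero] at h
    exact (smul_ne_zero htW hX) h
  have hXW : B X W = 0 := by rw [hs, hWX]
  simp only [map_sub, map_smul, smul_eq_mul, sub_apply, smul_apply, hWX, hXW] at hw
  have : 0 < B t W ^ 2 * B X X := by nlinarith [sq_nonneg (B t X)]
  exact pos_of_mul_pos_right this (sq_nonneg _)

/-- Future-directed timelike vectors have negative product with future-directed causal ones. -/
theorem neg_of_causal_of_timelike (hs : ∀ X Y, B X Y = B Y X)
    (hB : ∃ t, B t t < 0 ∧ ∀ X, B t X = 0 → X ≠ 0 → 0 < B X X)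
    {T W X : V} (hT : B T T < 0) (hW : B W W < 0) (hTW : B T W < 0)
    (hX : X ≠ 0) (hXX : B X X ≤ 0) (hTX : B T X ≤ 0) : B W X < 0 := by
  by_contra! hWX
  have hTX' : B T X < 0 := hTX.lt_of_ne fun h ↦
    absurd (pos_of_orthogonal_timelike hs hB hT h hX) (by linarith)
  -- a nonnegative combination of `T` and `W` is timelike and orthogonal to `X`
  have h1 : B (B W X • T - B T X • W) X = 0 := by simp; ring
  have h2 : B (B W X • T - B T X • W) (B W X • T - B T X • W) < 0 := by
    simp only [map_sub, map_smul, smul_eq_mul, sub_apply, smul_apply, hs W T]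
    have e1 : 0 ≤ B W X * B W X * -B T T := mul_nonneg (mul_self_nonneg _) (by linarith)
    have e2 : 0 < B T X * B T X * -B W W := mul_pos (mul_pos_of_neg_of_neg hTX' hTX') (by linarith)
    have e3 : 0 ≤ (B W X * -B T X) * -B T W :=
      mul_nonneg (mul_nonneg hWX (by linarith)) (by linarith)
    nlinarith
  exact absurd (pos_of_orthogonal_timelike hs hB h2 h1 hX) (by linarith)

/-- Orthogonal null vectors are proportional. -/
theorem exists_smul_of_null_orthogonal
    (hB : ∃ t, B t t < 0 ∧ ∀ X, B t X = 0 → X ≠ 0 → 0 < B X X)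
    {L X : V} (hL0 : L ≠ 0) (hL : B L L = 0) (hX : B X X = 0) (hLX : B L X = 0)
    (hXL : B X L = 0) : ∃ a : ℝ, X = a • L := by
  obtain ⟨t, -, ht⟩ := hB
  have htL : B t L ≠ 0 := fun h ↦ absurd (ht L h hL0) (by simp [hL])
  refine ⟨B t X / B t L, ?_⟩
  by_contra hne
  have h := ht (X - (B t X / B t L) • L) (by simp; field_simp; ring) (sub_ne_zero.2 hne)
  simp [hL, hX, hLX, hXL] at h

/-- In dimension four, a null vector orthogonal to a spacelike plane is proportional to one of any
two independent null normals of that plane: otherwise the three null normals, having pairwise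
nonzero products of the same sign, would be independent, and together with the plane they would
span five dimensions. -/
theorem null_normal_proportional [FiniteDimensional ℝ V] (hdim : Module.finrank ℝ V = 4)
    (hs : ∀ X Y, B X Y = B Y X)
    (hB : ∃ t, B t t < 0 ∧ ∀ X, B t X = 0 → X ≠ 0 → 0 < B X X)
    {T X L₁ L₂ e₁ e₂ : V} (hT : B T T < 0)
    (hX : B X X = 0) (hTX : B T X < 0) (hL₁ : B L₁ L₁ = 0) (hTL₁ : B T L₁ < 0)
    (hL₂ : B L₂ L₂ = 0) (hTL₂ : B T L₂ < 0) (hL : LinearIndependent ℝ ![L₁, L₂])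
    (h11 : B e₁ e₁ = 1) (h22 : B e₂ e₂ = 1) (h12 : B e₁ e₂ = 0)
    (hX1 : B X e₁ = 0) (hX2 : B X e₂ = 0) (hL11 : B L₁ e₁ = 0) (hL12 : B L₁ e₂ = 0)
    (hL21 : B L₂ e₁ = 0) (hL22 : B L₂ e₂ = 0) :
    (∃ a : ℝ, 0 < a ∧ X = a • L₁) ∨ ∃ a : ℝ, 0 < a ∧ X = a • L₂ := by
  have ne0 : ∀ {Y}, B T Y < 0 → Y ≠ 0 := by rintro Y h rfl; simp at h
  have key : ∀ {L Y}, B L L = 0 → B T L < 0 → B Y Y = 0 → B T Y < 0 → B L Y = 0 →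
      ∃ a : ℝ, 0 < a ∧ Y = a • L := by
    intro L Y hL hTL hY hTY h
    obtain ⟨a, rfl⟩ := exists_smul_of_null_orthogonal hB (ne0 hTL) hL hY h (by rw [hs, h])
    refine ⟨a, ?_, rfl⟩
    simp only [map_smul, smul_eq_mul] at hTY
    by_contra! ha
    nlinarith
  -- two nonzero null vectors in the same half cone have nonpositive product
  have nonpos : ∀ {L Y}, B L L = 0 → B T L < 0 → B Y Y = 0 → B T Y < 0 → B L Y ≤ 0 := by
    intro L Y hL hTL hY hTY
    by_contra! h
    have h1 : B T (B T Y • L - B T L • Y) = 0 := by simp; ring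
    have h2 : B (B T Y • L - B T L • Y) (B T Y • L - B T L • Y) < 0 := by
      simp only [map_sub, map_smul, smul_eq_mul, sub_apply, smul_apply, hL, hY, hs Y L]
      nlinarith [mul_pos (mul_pos_of_neg_of_neg hTL hTY) h]
    have h3 := pos_of_orthogonal_timelike hs hB hT h1 (by intro h0; simp [h0] at h2)
    linarith
  by_contra! hcon
  have c1 : B X L₁ < 0 := (nonpos hX hTX hL₁ hTL₁).lt_of_ne fun h ↦ by
    obtain ⟨a, ha, h⟩ := key hL₁ hTL₁ hX hTX (by rw [hs, h]); exact hcon.1 a ha h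
  have c2 : B X L₂ < 0 := (nonpos hX hTX hL₂ hTL₂).lt_of_ne fun h ↦ by
    obtain ⟨a, ha, h⟩ := key hL₂ hTL₂ hX hTX (by rw [hs, h]); exact hcon.2 a ha h
  have c3 : B L₁ L₂ < 0 := (nonpos hL₁ hTL₁ hL₂ hTL₂).lt_of_ne fun h ↦ by
    obtain ⟨a, ha, h⟩ := key hL₁ hTL₁ hL₂ hTL₂ h
    have := (LinearIndependent.pair_iff.1 hL) a (-1) (by rw [h]; simp)
    simp at this
  have hli : LinearIndependent ℝ ![X, L₁, L₂, e₁, e₂] := by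
    rw [Fintype.linearIndependent_iff]
    intro c hc
    simp only [Fin.sum_univ_five] at hc
    simp at hc
    have p : ∀ Z, B Z (c 0 • X + c 1 • L₁ + c 2 • L₂ + c 3 • e₁ + c 4 • e₂) = 0 := by
      intro Z; rw [hc]; simp
    have pX := p X
    have p1 := p L₁
    have p2 := p L₂
    have p3 := p e₁
    have p4 := p e₂
    simp only [map_add, map_smul, smul_eq_mul, hs e₁ X, hs e₁ L₁, hs e₁ L₂, hs e₂ X, hs e₂ L₁,
      hs e₂ L₂, hs e₂ e₁, hs L₁ X, hs L₂ X, hs L₂ L₁, h11, h22, h12, hX1, hX2, hL11, hL12, hL21,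
      hL22, hX, hL₁, hL₂] at pX p1 p2 p3 p4
    have h3 : c 3 = 0 := by linarith
    have h4 : c 4 = 0 := by linarith
    -- the Gram determinant of the three null vectors is `2 * (B X L₁) * (B X L₂) * (B L₁ L₂)`
    have h0 : c 0 = 0 := by
      have : c 0 * (B X L₁ * B X L₂) = 0 := by
        linear_combination (B X L₂ * p1 + B X L₁ * p2 - B L₁ L₂ * pX) / 2
      exact (mul_eq_zero.1 this).resolve_right (mul_pos_of_neg_of_neg c1 c2).ne'
    have h2 : c 2 = 0 := by
      have : c 2 * B L₁ L₂ = 0 := by rw [h0] at p1; linarith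
      exact (mul_eq_zero.1 this).resolve_right c3.ne
    have h1 : c 1 = 0 := by
      have : c 1 * B L₁ L₂ = 0 := by rw [h0] at p2; linarith
      exact (mul_eq_zero.1 this).resolve_right c3.ne
    intro i
    fin_cases i <;> assumption
  have := hli.fintype_card_le_finrank
  simp [hdim] at this

end LorentzianAlgebra

/-- A symmetric positive definite form on a plane has an orthonormal pair of vectors. -/
theorem exists_orthonormal_pair {V : Type*} [AddCommGroup V] [Module ℝ V]
    (hdim : 2 ≤ Module.finrank ℝ V) (Q : V → V → ℝ) (hs : ∀ X Y, Q X Y = Q Y X)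
    (hadd : ∀ X Y Z, Q (X + Y) Z = Q X Z + Q Y Z) (hsmul : ∀ (a : ℝ) X Y, Q (a • X) Y = a * Q X Y)
    (hpos : ∀ X, X ≠ 0 → 0 < Q X X) : ∃ e₁ e₂, Q e₁ e₁ = 1 ∧ Q e₂ e₂ = 1 ∧ Q e₁ e₂ = 0 := by
  have hsmul' : ∀ (a : ℝ) X Y, Q X (a • Y) = a * Q X Y := fun a X Y ↦ by rw [hs, hsmul, hs]
  have unit : ∀ X, X ≠ 0 → Q ((√(Q X X))⁻¹ • X) ((√(Q X X))⁻¹ • X) = 1 := by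
    intro X hX
    have h := hpos X hX
    rw [hsmul, hsmul', ← mul_assoc, ← mul_inv, Real.mul_self_sqrt h.le, inv_mul_cancel₀ h.ne']
  obtain ⟨f, hf⟩ : ∃ f : Fin 2 → V, LinearIndependent ℝ f :=
    exists_linearIndependent_of_le_finrank hdim
  have hf' := LinearIndependent.pair_iff.1 (show LinearIndependent ℝ ![f 0, f 1] by
    convert hf using 1; ext i; fin_cases i <;> rfl)
  have h0 : f 0 ≠ 0 := hf.ne_zero 0
  set a := f 0
  have ha := hpos a h0
  set b := f 1 + (-(Q a (f 1) / Q a a)) • a with hb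
  have hb0 : b ≠ 0 := by
    intro h
    have := hf' (-(Q a (f 1) / Q a a)) 1 (by rw [one_smul, add_comm, ← hb, h])
    simp at this
  refine ⟨_, _, unit a h0, unit b hb0, ?_⟩
  have : Q a b = 0 := by
    rw [hs, hb, hadd, hsmul, hs (f 1) a]; field_simp; ring
  rw [hsmul, hsmul', this]; simp

/-! ### Second derivatives at a minimum -/

theorem IsLocalMin.deriv_deriv_nonneg {f : ℝ → ℝ} {t : ℝ} (h : IsLocalMin f t)
    (hc : ContinuousAt f t) : 0 ≤ deriv (deriv f) t := by
  by_contra! hneg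
  -- otherwise the point is also a local maximum, and the function is locally constant
  have hmax := isLocalMax_of_deriv_deriv_neg hneg h.deriv_eq_zero hc
  have hconst : f =ᶠ[𝓝 t] fun _ ↦ f t := by
    filter_upwards [h, hmax] with s h1 h2 using le_antisymm h2 h1
  have h2 : deriv (deriv f) t = 0 := by
    rw [hconst.deriv.deriv_eq]; simp
  linarith

/-! ### Double null metrics in coordinates -/

section DoubleNull

variable {E F : Type*} [NormedAddCommGroup E] [NormedSpace ℝ E] [NormedAddCommGroup F]
  [InnerProductSpace ℝ F]

/-- The symmetric bilinear form `-Ω du dv + R ⟨dn, dn⟩` at the point `y` of a coordinate space, for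
functions `u`, `v` and a vector-valued map `n`. -/
noncomputable def doubleNullForm (Om R u v : E → ℝ) (n : E → F) (y a b : E) : ℝ :=
  - Om y / 2 * (fderiv ℝ u y a * fderiv ℝ v y b + fderiv ℝ v y a * fderiv ℝ u y b)
    + R y * inner ℝ (fderiv ℝ n y a) (fderiv ℝ n y b)

variable {Om R u v : E → ℝ} {n : E → F}

theorem hasFDerivAt_fderiv_apply {G : Type*} [NormedAddCommGroup G] [NormedSpace ℝ G]
    {Z : Type*} [NormedAddCommGroup Z] [NormedSpace ℝ Z] {w : E → G} {y a : Z → E} {z : Z}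
    {y' a' : Z →L[ℝ] E} (hw : ContDiffAt ℝ 2 w (y z)) (hy : HasFDerivAt y y' z)
    (ha : HasFDerivAt a a' z) :
    ∃ D : Z →L[ℝ] G, HasFDerivAt (fun t ↦ fderiv ℝ w (y t) (a t)) D z ∧
      ∀ ζ, D ζ = fderiv ℝ (fderiv ℝ w) (y z) (y' ζ) (a z) + fderiv ℝ w (y z) (a' ζ) := by
  have h1 : DifferentiableAt ℝ (fderiv ℝ w) (y z) :=
    (hw.fderiv_right (m := 1) (by norm_num)).differentiableAt (by norm_num)
  refine ⟨_, (h1.hasFDerivAt.comp z hy).clm_apply ha, fun ζ ↦ ?_⟩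
  simp [add_comm]

/-- The product rule for a double null form along a differentiable family of points and vectors. -/
theorem hasFDerivAt_doubleNullForm {Z : Type*} [NormedAddCommGroup Z] [NormedSpace ℝ Z]
    {y a b : Z → E} {z : Z} {y' a' b' : Z →L[ℝ] E}
    (hOm : DifferentiableAt ℝ Om (y z)) (hR : DifferentiableAt ℝ R (y z))
    (hu : ContDiffAt ℝ 2 u (y z)) (hv : ContDiffAt ℝ 2 v (y z)) (hn : ContDiffAt ℝ 2 n (y z))
    (hy : HasFDerivAt y y' z) (ha : HasFDerivAt a a' z) (hb : HasFDerivAt b b' z) :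
    ∃ D : Z →L[ℝ] ℝ, HasFDerivAt (fun t ↦ doubleNullForm Om R u v n (y t) (a t) (b t)) D z ∧
      ∀ ζ, D ζ =
        - fderiv ℝ Om (y z) (y' ζ) / 2 * (fderiv ℝ u (y z) (a z) * fderiv ℝ v (y z) (b z)
          + fderiv ℝ v (y z) (a z) * fderiv ℝ u (y z) (b z))
        - Om (y z) / 2 *
          ((fderiv ℝ (fderiv ℝ u) (y z) (y' ζ) (a z) + fderiv ℝ u (y z) (a' ζ))
              * fderiv ℝ v (y z) (b z)
            + fderiv ℝ u (y z) (a z) *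
              (fderiv ℝ (fderiv ℝ v) (y z) (y' ζ) (b z) + fderiv ℝ v (y z) (b' ζ))
            + (fderiv ℝ (fderiv ℝ v) (y z) (y' ζ) (a z) + fderiv ℝ v (y z) (a' ζ))
              * fderiv ℝ u (y z) (b z)
            + fderiv ℝ v (y z) (a z) *
              (fderiv ℝ (fderiv ℝ u) (y z) (y' ζ) (b z) + fderiv ℝ u (y z) (b' ζ)))
        + fderiv ℝ R (y z) (y' ζ) * inner ℝ (fderiv ℝ n (y z) (a z)) (fderiv ℝ n (y z) (b z))
        + R (y z) *
          (inner ℝ (fderiv ℝ (fderiv ℝ n) (y z) (y' ζ) (a z) + fderiv ℝ n (y z) (a' ζ))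
              (fderiv ℝ n (y z) (b z))
            + inner ℝ (fderiv ℝ n (y z) (a z))
              (fderiv ℝ (fderiv ℝ n) (y z) (y' ζ) (b z) + fderiv ℝ n (y z) (b' ζ))) := by
  obtain ⟨Dua, hDua, eua⟩ := hasFDerivAt_fderiv_apply hu hy ha
  obtain ⟨Dub, hDub, eub⟩ := hasFDerivAt_fderiv_apply hu hy hb
  obtain ⟨Dva, hDva, eva⟩ := hasFDerivAt_fderiv_apply hv hy ha
  obtain ⟨Dvb, hDvb, evb⟩ := hasFDerivAt_fderiv_apply hv hy hb
  obtain ⟨Dna, hDna, ena⟩ := hasFDerivAt_fderiv_apply hn hy ha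
  obtain ⟨Dnb, hDnb, enb⟩ := hasFDerivAt_fderiv_apply hn hy hb
  have hO := hOm.hasFDerivAt.comp z hy
  have hR' := hR.hasFDerivAt.comp z hy
  have h := ((hO.mul_const (-(1 / 2) : ℝ)).mul ((hDua.mul hDvb).add (hDva.mul hDub))).add
    (hR'.mul (hDna.inner ℝ hDnb))
  refine ⟨_, h.congr_of_eventuallyEq (.of_forall fun t ↦ ?_), fun ζ ↦ ?_⟩
  · simp [doubleNullForm]; ring
  · simp [← eua, ← eub, ← eva, ← evb, ← ena, ← enb, fderivInnerCLM_apply]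
    ring

/-- The null second fundamental form of a surface in direction `e`, at a critical point of `u`
restricted to the curve `c` in the surface. Here `lam` is a vector field that is orthogonal to `c'`
along `c` and equals a multiple of `∂_v` at `c 0`; the left side is `g(∇_e lam, e)` with the
Christoffel symbols of the double null form written out. The terms in which the second derivatives
of `u` and `n` are contracted with `lam` and `e` cancel by their symmetry. -/
theorem doubleNullForm_secondFF {c : ℝ → E} {lam : E → E}
    (hOm : DifferentiableAt ℝ Om (c 0)) (hR : DifferentiableAt ℝ R (c 0))
    (hu : ContDiffAt ℝ 2 u (c 0)) (hv : ContDiffAt ℝ 2 v (c 0)) (hn : ContDiffAt ℝ 2 n (c 0))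
    (hlam : DifferentiableAt ℝ lam (c 0)) (hc : ContDiffAt ℝ 2 c 0)
    (horth : ∀ᶠ s in 𝓝 (0 : ℝ), doubleNullForm Om R u v n (c s) (lam (c s)) (deriv c s) = 0)
    (hlu : fderiv ℝ u (c 0) (lam (c 0)) = 0) (hln : fderiv ℝ n (c 0) (lam (c 0)) = 0)
    (heu : fderiv ℝ u (c 0) (deriv c 0) = 0) :
    doubleNullForm Om R u v n (c 0) (fderiv ℝ lam (c 0) (deriv c 0)) (deriv c 0)
      + (fderiv ℝ (fun y ↦ doubleNullForm Om R u v n y (lam (c 0)) (deriv c 0)) (c 0) (deriv c 0)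
        + fderiv ℝ (fun y ↦ doubleNullForm Om R u v n y (deriv c 0) (deriv c 0)) (c 0) (lam (c 0))
        - fderiv ℝ (fun y ↦ doubleNullForm Om R u v n y (deriv c 0) (lam (c 0))) (c 0)
          (deriv c 0)) / 2
      = fderiv ℝ R (c 0) (lam (c 0)) / 2 * ‖fderiv ℝ n (c 0) (deriv c 0)‖ ^ 2
        + Om (c 0) / 2 * fderiv ℝ v (c 0) (lam (c 0)) * deriv (deriv (u ∘ c)) 0 := by
  have hc1 : HasDerivAt c (deriv c 0) 0 := (hc.differentiableAt (by norm_num)).hasDerivAt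
  have hc2 : HasDerivAt (deriv c) (deriv (deriv c) 0) 0 := by
    have : DifferentiableAt ℝ (deriv c) 0 := by
      have h := (hc.fderiv_right (m := 1) (by norm_num)).differentiableAt (by norm_num)
      exact h.clm_apply (differentiableAt_const (1 : ℝ))
    exact this.hasDerivAt
  have hl := hlam.hasFDerivAt.comp (0 : ℝ) hc1.hasFDerivAt
  -- differentiate the orthogonality relation along the curve
  obtain ⟨D, hD, eD⟩ := hasFDerivAt_doubleNullForm hOm hR hu hv hn hc1.hasFDerivAt hl
    hc2.hasFDerivAt
  have hD0 : D 1 = 0 := by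
    have h0 : HasFDerivAt (fun s ↦ doubleNullForm Om R u v n (c s) (lam (c s)) (deriv c s))
        (0 : ℝ →L[ℝ] ℝ) 0 :=
      (hasFDerivAt_const (0 : ℝ) (0 : ℝ)).congr_of_eventuallyEq horth
    rw [hD.unique h0]; rfl
  rw [eD] at hD0
  have cst : ∀ a b : E, _ := fun a b ↦ hasFDerivAt_doubleNullForm (y := id) (z := c 0) hOm hR hu hv
    hn (hasFDerivAt_id (c 0)) (hasFDerivAt_const a (c 0)) (hasFDerivAt_const b (c 0))
  obtain ⟨D1, hD1, eD1⟩ := cst (lam (c 0)) (deriv c 0)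
  obtain ⟨D2, hD2, eD2⟩ := cst (deriv c 0) (deriv c 0)
  obtain ⟨D3, hD3, eD3⟩ := cst (deriv c 0) (lam (c 0))
  -- the second derivative of `u` along the curve
  obtain ⟨D4, hD4, eD4⟩ := hasFDerivAt_fderiv_apply hu hc1.hasFDerivAt hc2.hasFDerivAt
  have h4 : deriv (deriv (u ∘ c)) 0 = D4 1 := by
    have hev : deriv (u ∘ c) =ᶠ[𝓝 0] fun s ↦ fderiv ℝ u (c s) (deriv c s) := by
      have e1 := hc.continuousAt.eventually (hu.eventually (by simp))
      filter_upwards [e1, hc.eventually (by simp)] with s h1 h2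
      exact fderiv_comp_deriv s (h1.differentiableAt (by norm_num))
        (h2.differentiableAt (by norm_num))
    rw [hev.deriv_eq]
    exact hD4.hasDerivAt.deriv
  rw [h4, eD4]
  simp only [id_eq] at hD1 hD2 hD3 eD1 eD2 eD3
  rw [hD1.fderiv, hD2.fderiv, hD3.fderiv, eD1, eD2, eD3]
  have su : fderiv ℝ (fderiv ℝ u) (c 0) (lam (c 0)) (deriv c 0)
      = fderiv ℝ (fderiv ℝ u) (c 0) (deriv c 0) (lam (c 0)) :=
    (hu.isSymmSndFDerivAt (by simp)).eq _ _
  have sn : fderiv ℝ (fderiv ℝ n) (c 0) (lam (c 0)) (deriv c 0)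
      = fderiv ℝ (fderiv ℝ n) (c 0) (deriv c 0) (lam (c 0)) :=
    (hn.isSymmSndFDerivAt (by simp)).eq _ _
  simp [hlu, hln, heu, su, sn, doubleNullForm, inner_add_left, inner_add_right,
    real_inner_comm] at hD0 ⊢
  linear_combination hD0

end DoubleNull

/-! ### Tensors in the preferred chart -/

section Chart

variable {M : Type*} [TopologicalSpace M] [ChartedSpace E4 M]

theorem dReal_eq_fderiv {p : M} {f : M → ℝ} (hf : MDifferentiableAt (𝓡 4) 𝓘(ℝ, ℝ) f p)
    (X : TangentSpace (𝓡 4) p) :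
    dReal f X = fderiv ℝ (f ∘ (extChartAt (𝓡 4) p).symm) (extChartAt (𝓡 4) p p) (X : E4) := by
  rw [dReal, hf.mfderiv]
  simp [writtenInExtChartAt, Function.comp_def]
  rfl

theorem dSphere_eq_fderiv {p : M} {n : M → S2}
    (hn : MDifferentiableAt (𝓡 4) 𝓘(ℝ, E3) (fun q ↦ (n q : E3)) p) (X : TangentSpace (𝓡 4) p) :
    dSphere n X = fderiv ℝ ((fun q ↦ (n q : E3)) ∘ (extChartAt (𝓡 4) p).symm)
      (extChartAt (𝓡 4) p p) (X : E4) := by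
  rw [dSphere, hn.mfderiv]
  simp [writtenInExtChartAt, Function.comp_def]
  rfl

theorem tendsto_extChartAt_symm (p : M) :
    Filter.Tendsto (extChartAt (𝓡 4) p).symm (𝓝 (extChartAt (𝓡 4) p p)) (𝓝 p) := by
  simpa [ContinuousAt] using continuousAt_extChartAt_symm (I := 𝓡 4) p

variable [IsManifold (𝓡 4) ∞ M]

theorem contMDiffAt_extChartAt_symm_of_mem_target {p : M} {y : E4}
    (hy : y ∈ (extChartAt (𝓡 4) p).target) :
    ContMDiffAt 𝓘(ℝ, E4) (𝓡 4) ∞ (extChartAt (𝓡 4) p).symm y :=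
  (contMDiffOn_extChartAt_symm p y hy).contMDiffAt
    ((isOpen_extChartAt_target p).mem_nhds hy)

theorem dReal_mfderiv_symm {p : M} {y : E4} (hy : y ∈ (extChartAt (𝓡 4) p).target) {f : M → ℝ}
    (hf : MDifferentiableAt (𝓡 4) 𝓘(ℝ, ℝ) f ((extChartAt (𝓡 4) p).symm y)) (a : E4) :
    dReal f (mfderiv 𝓘(ℝ, E4) (𝓡 4) (extChartAt (𝓡 4) p).symm y a)
      = fderiv ℝ (f ∘ (extChartAt (𝓡 4) p).symm) y a := by
  have h := mfderiv_comp y hf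
    ((contMDiffAt_extChartAt_symm_of_mem_target hy).mdifferentiableAt (by simp))
  rw [mfderiv_eq_fderiv] at h
  rw [h]; rfl

theorem dSphere_mfderiv_symm {p : M} {y : E4} (hy : y ∈ (extChartAt (𝓡 4) p).target) {n : M → S2}
    (hn : MDifferentiableAt (𝓡 4) 𝓘(ℝ, E3) (fun q ↦ (n q : E3)) ((extChartAt (𝓡 4) p).symm y))
    (a : E4) :
    dSphere n (mfderiv 𝓘(ℝ, E4) (𝓡 4) (extChartAt (𝓡 4) p).symm y a)
      = fderiv ℝ ((fun q ↦ (n q : E3)) ∘ (extChartAt (𝓡 4) p).symm) y a := by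
  have h := mfderiv_comp y hn
    ((contMDiffAt_extChartAt_symm_of_mem_target hy).mdifferentiableAt (by simp))
  rw [mfderiv_eq_fderiv] at h
  rw [h]; rfl

/-- A `C^m` map to a normed space, read in the preferred chart. -/
theorem ContMDiffAt.comp_extChartAt_symm {G : Type*} [NormedAddCommGroup G] [NormedSpace ℝ G]
    {m : ℕ∞} {p : M} {f : M → G} (hf : ContMDiffAt (𝓡 4) 𝓘(ℝ, G) m f p) :
    ContDiffAt ℝ m (f ∘ (extChartAt (𝓡 4) p).symm) (extChartAt (𝓡 4) p p) := by
  have h := contMDiffAt_extChartAt_symm_of_mem_target (mem_extChartAt_target (I := 𝓡 4) p)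
  have h2 := ContMDiffAt.comp_of_eq hf (h.of_le (m := m) (by exact_mod_cast le_top))
    (extChartAt_to_inv p)
  exact h2.contDiffAt

theorem mfderiv_symm_mfderiv {p : M} {y : E4} (hy : y ∈ (extChartAt (𝓡 4) p).target)
    (X : TangentSpace (𝓡 4) ((extChartAt (𝓡 4) p).symm y)) :
    mfderiv 𝓘(ℝ, E4) (𝓡 4) (extChartAt (𝓡 4) p).symm y
      (mfderiv (𝓡 4) 𝓘(ℝ, E4) (extChartAt (𝓡 4) p) ((extChartAt (𝓡 4) p).symm y) X) = X := by
  have : IsManifold (𝓡 4) 1 M := IsManifold.of_le (n := ∞) (by exact_mod_cast le_top)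
  have h := mfderivWithin_extChartAt_symm_comp_mfderiv_extChartAt (I := 𝓡 4) hy
  have hr : range (𝓡 4) = univ := by simp
  rw [hr, mfderivWithin_univ] at h
  exact congr($h X)

/-- The components in the preferred chart at `p` of a vector field. -/
noncomputable def chartField (L : ∀ x : M, TangentSpace (𝓡 4) x) (p : M) (y : E4) : E4 :=
  mfderiv (𝓡 4) 𝓘(ℝ, E4) (extChartAt (𝓡 4) p) ((extChartAt (𝓡 4) p).symm y)
    (L ((extChartAt (𝓡 4) p).symm y))

theorem chartField_self (L : ∀ x : M, TangentSpace (𝓡 4) x) (p : M) :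
    chartField L p (extChartAt (𝓡 4) p p) = L p := by
  have : IsManifold (𝓡 4) 1 M := IsManifold.of_le (n := ∞) (by exact_mod_cast le_top)
  have h : ∀ q, q = p → (mfderiv (𝓡 4) 𝓘(ℝ, E4) (extChartAt (𝓡 4) p) q (L q) : E4) = L p := by
    rintro q rfl
    rw [mfderiv_extChartAt_self]; rfl
  exact h _ (extChartAt_to_inv p)

theorem differentiableAt_chartField {L : ∀ x : M, TangentSpace (𝓡 4) x} {p : M}
    (hL : ContMDiffAt (𝓡 4) (𝓡 4).tangent 1 (fun x ↦ (⟨x, L x⟩ : TangentBundle (𝓡 4) M)) p) :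
    DifferentiableAt ℝ (chartField L p) (extChartAt (𝓡 4) p p) := by
  have : IsManifold (𝓡 4) 1 M := IsManifold.of_le (n := ∞) (by exact_mod_cast le_top)
  have h := (Bundle.contMDiffAt_totalSpace.1 hL).2
  have h2 : (fun x ↦ (trivializationAt E4 (TangentSpace (𝓡 4)) p
      (⟨x, L x⟩ : TangentBundle (𝓡 4) M)).2) =ᶠ[𝓝 p]
      fun x ↦ (mfderiv (𝓡 4) 𝓘(ℝ, E4) (extChartAt (𝓡 4) p) x (L x) : E4) := by
    filter_upwards [(chartAt E4 p).open_source.mem_nhds (mem_chart_source E4 p)] with x hx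
    have hx' : x ∈ (trivializationAt E4 (TangentSpace (𝓡 4)) p).baseSet := by simpa using hx
    have e := congr($(TangentBundle.continuousLinearMapAt_trivializationAt (𝕜 := ℝ)
      (I := 𝓡 4) hx) (L x))
    refine Eq.trans ?_ e
    exact (Bundle.Trivialization.continuousLinearMapAt_apply_of_mem ℝ
      (trivializationAt E4 (TangentSpace (𝓡 4)) p) hx' (L x)).symm
  have h3 := (h.congr_of_eventuallyEq h2.symm)
  exact (ContMDiffAt.comp_extChartAt_symm (m := 1) h3).differentiableAt (by norm_num)

end Chart

/-! ### Coordinate lines of a surface -/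

section SurfaceCurve

variable {M : Type*} [TopologicalSpace M] [ChartedSpace E4 M]
  {N : Type*} [TopologicalSpace N] [ChartedSpace (EuclideanSpace ℝ (Fin 2)) N] {ι : N → M}

/-- A coordinate line through `q` in a surface, read in the preferred chart of `M` at `ι q`. -/
noncomputable def surfaceCurve (ι : N → M) (q : N) (X : EuclideanSpace ℝ (Fin 2)) (s : ℝ) : E4 :=
  extChartAt (𝓡 4) (ι q) (ι ((extChartAt (𝓡 2) q).symm (extChartAt (𝓡 2) q q + s • X)))

theorem surfaceCurve_zero (q : N) (X : EuclideanSpace ℝ (Fin 2)) :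
    surfaceCurve ι q X 0 = extChartAt (𝓡 4) (ι q) (ι q) := by
  simp [surfaceCurve]

theorem tendsto_surfaceParam (q : N) (X : EuclideanSpace ℝ (Fin 2)) :
    Filter.Tendsto (fun s : ℝ ↦ (extChartAt (𝓡 2) q).symm (extChartAt (𝓡 2) q q + s • X))
      (𝓝 0) (𝓝 q) := by
  have h1 : ContinuousAt (fun s : ℝ ↦ extChartAt (𝓡 2) q q + s • X) 0 := by fun_prop
  have h2 := continuousAt_extChartAt_symm (I := 𝓡 2) q
  have h3 := ContinuousAt.comp_of_eq h2 h1 (by simp)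
  simpa [ContinuousAt, Function.comp_def] using h3

theorem contDiffAt_surfaceCurve {q : N} (hι : ContMDiffAt (𝓡 2) (𝓡 4) 2 ι q)
    (X : EuclideanSpace ℝ (Fin 2)) : ContDiffAt ℝ 2 (surfaceCurve ι q X) 0 := by
  have h := (contMDiffAt_iff.1 hι).2
  simp only [ModelWithCorners.range_eq_univ, contDiffWithinAt_univ] at h
  have h1 : ContDiffAt ℝ 2 (fun s : ℝ ↦ extChartAt (𝓡 2) q q + s • X) 0 := by fun_prop
  rw [show extChartAt (𝓡 2) q q = extChartAt (𝓡 2) q q + (0 : ℝ) • X by simp] at h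
  exact ContDiffAt.comp (0 : ℝ) (f := fun s : ℝ ↦ extChartAt (𝓡 2) q q + s • X) h h1

theorem deriv_surfaceCurve {q : N} (hι : ContMDiffAt (𝓡 2) (𝓡 4) 2 ι q)
    (X : EuclideanSpace ℝ (Fin 2)) :
    deriv (surfaceCurve ι q X) 0 = mfderiv (𝓡 2) (𝓡 4) ι q (X : TangentSpace (𝓡 2) q) := by
  have h := (contMDiffAt_iff.1 hι).2
  simp only [ModelWithCorners.range_eq_univ, contDiffWithinAt_univ] at h
  have hd := (h.differentiableAt (by norm_num)).hasFDerivAt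
  rw [(hι.mdifferentiableAt (by norm_num)).mfderiv]
  simp only [ModelWithCorners.range_eq_univ, fderivWithin_univ]
  have h1 : HasDerivAt (fun s : ℝ ↦ extChartAt (𝓡 2) q q + s • X) X 0 := by
    simpa using ((hasDerivAt_id (0 : ℝ)).smul_const X).const_add
      (extChartAt (𝓡 2) q q)
  exact (HasFDerivAt.comp_hasDerivAt_of_eq (0 : ℝ) hd h1 (by simp)).deriv

theorem symm_surfaceCurve {q : N} (hι : ContMDiffAt (𝓡 2) (𝓡 4) 2 ι q)
    (X : EuclideanSpace ℝ (Fin 2)) :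
    ∀ᶠ s in 𝓝 (0 : ℝ), (extChartAt (𝓡 4) (ι q)).symm (surfaceCurve ι q X s)
      = ι ((extChartAt (𝓡 2) q).symm (extChartAt (𝓡 2) q q + s • X)) := by
  have h := (hι.continuousAt.tendsto.comp (tendsto_surfaceParam q X)).eventually
    (extChartAt_source_mem_nhds (I := 𝓡 4) (ι q))
  filter_upwards [h] with s hs using (extChartAt (𝓡 4) (ι q)).left_inv hs

theorem dReal_mfderiv {f : M → ℝ} {q : N} (hf : MDifferentiableAt (𝓡 4) 𝓘(ℝ, ℝ) f (ι q))
    (hι : MDifferentiableAt (𝓡 2) (𝓡 4) ι q) (Y : TangentSpace (𝓡 2) q) :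
    dReal f (mfderiv (𝓡 2) (𝓡 4) ι q Y) = mfderiv (𝓡 2) 𝓘(ℝ, ℝ) (f ∘ ι) q Y := by
  rw [mfderiv_comp q hf hι]; rfl

end SurfaceCurve

/-! ### The null second fundamental form at an extremum of a null coordinate -/

section SecondFF

variable {M : Type*} [TopologicalSpace M] [ChartedSpace E4 M] [IsManifold (𝓡 4) ∞ M]
  {k : ℕ∞} {g : LorentzMetric k M} {τ : TimeOrientation g}

/-- Near `p` the metric has the form `-Ω du dv + R n^* g_{S²}`, with `u`, `v`, `n` of class `C²` and
`Ω`, `R` of class `C¹` at `p`. -/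
structure DoubleNullAt (g : LorentzMetric k M) (p : M) (u v : M → ℝ) (n : M → S2)
    (Om R : M → ℝ) : Prop where
  contMDiffAt_u : ContMDiffAt (𝓡 4) 𝓘(ℝ, ℝ) 2 u p
  contMDiffAt_v : ContMDiffAt (𝓡 4) 𝓘(ℝ, ℝ) 2 v p
  contMDiffAt_n : ContMDiffAt (𝓡 4) 𝓘(ℝ, E3) 2 (fun q ↦ (n q : E3)) p
  contMDiffAt_Om : ContMDiffAt (𝓡 4) 𝓘(ℝ, ℝ) 1 Om p
  contMDiffAt_R : ContMDiffAt (𝓡 4) 𝓘(ℝ, ℝ) 1 R p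
  metric : ∀ᶠ q in 𝓝 p, ∀ X Y : TangentSpace (𝓡 4) q,
    g.val q X Y = - Om q / 2 * (dReal u X * dReal v Y + dReal v X * dReal u Y)
      + R q * inner ℝ (dSphere n X) (dSphere n Y)

variable {p : M} {u v : M → ℝ} {n : M → S2} {Om R : M → ℝ}

theorem DoubleNullAt.swap (h : DoubleNullAt g p u v n Om R) : DoubleNullAt g p v u n Om R where
  contMDiffAt_u := h.contMDiffAt_v
  contMDiffAt_v := h.contMDiffAt_u
  contMDiffAt_n := h.contMDiffAt_n
  contMDiffAt_Om := h.contMDiffAt_Om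
  contMDiffAt_R := h.contMDiffAt_R
  metric := h.metric.mono fun q hq X Y ↦ by rw [hq]; ring

/-- At `p` itself the differential of the preferred chart is the identity of the model space. -/
theorem DoubleNullAt.val_eq (h : DoubleNullAt g p u v n Om R) (X Y : TangentSpace (𝓡 4) p) :
    g.val p X Y = doubleNullForm (Om ∘ (extChartAt (𝓡 4) p).symm) (R ∘ (extChartAt (𝓡 4) p).symm)
      (u ∘ (extChartAt (𝓡 4) p).symm) (v ∘ (extChartAt (𝓡 4) p).symm)
      ((fun q ↦ (n q : E3)) ∘ (extChartAt (𝓡 4) p).symm) (extChartAt (𝓡 4) p p) X Y := by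
  rw [h.metric.self_of_nhds]
  simp only [dReal_eq_fderiv (h.contMDiffAt_u.mdifferentiableAt (by norm_num)),
    dReal_eq_fderiv (h.contMDiffAt_v.mdifferentiableAt (by norm_num)),
    dSphere_eq_fderiv (h.contMDiffAt_n.mdifferentiableAt (by norm_num)), doubleNullForm,
    Function.comp_apply, extChartAt_to_inv]

theorem DoubleNullAt.coord_eq (h : DoubleNullAt g p u v n Om R) :
    ∀ᶠ y in 𝓝 (extChartAt (𝓡 4) p p), ∀ a b : E4, g.coord p a b y =
      doubleNullForm (Om ∘ (extChartAt (𝓡 4) p).symm) (R ∘ (extChartAt (𝓡 4) p).symm)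
      (u ∘ (extChartAt (𝓡 4) p).symm) (v ∘ (extChartAt (𝓡 4) p).symm)
      ((fun q ↦ (n q : E3)) ∘ (extChartAt (𝓡 4) p).symm) y a b := by
  have ev := tendsto_extChartAt_symm p
  filter_upwards [ev.eventually h.metric,
    ev.eventually ((contMDiffAt_iff_contMDiffAt_nhds (by simp)).1 h.contMDiffAt_u),
    ev.eventually ((contMDiffAt_iff_contMDiffAt_nhds (by simp)).1 h.contMDiffAt_v),
    ev.eventually ((contMDiffAt_iff_contMDiffAt_nhds (by simp)).1 h.contMDiffAt_n),
    (isOpen_extChartAt_target p).mem_nhds (mem_extChartAt_target (I := 𝓡 4) p)]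
    with y h1 h2 h3 h4 hy
  intro a b
  rw [LorentzMetric.coord, h1]
  simp only [dReal_mfderiv_symm hy (h2.mdifferentiableAt (by norm_num)),
    dReal_mfderiv_symm hy (h3.mdifferentiableAt (by norm_num)),
    dSphere_mfderiv_symm hy (h4.mdifferentiableAt (by norm_num)), doubleNullForm,
    Function.comp_apply]

variable {N : Type*} [TopologicalSpace N] [ChartedSpace (EuclideanSpace ℝ (Fin 2)) N] {ι : N → M}

/-- Suppose a null coordinate `u` restricted to a surface has a minimum at `q`, the surface lies in
a null hypersurface, and the null normal of the latter at `ι q` is a positive multiple of `X = ∂_v`.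
If the area of the symmetry spheres is nondecreasing along `X`, the null second fundamental form is
nonnegative on the tangent plane of the surface. -/
theorem DoubleNullAt.secondFF_nonneg {q : N} (h : DoubleNullAt g (ι q) u v n Om R) {U : Set M}
    (hU : IsOpen U) (hqU : ι q ∈ U) (H : NullHypersurface g τ U)
    (hι : ContMDiffAt (𝓡 2) (𝓡 4) 2 ι q) (hf : ∀ᶠ q' in 𝓝 q, H.f (ι q') = 0)
    (hmin : IsLocalMin (u ∘ ι) q) {a : ℝ} (ha : 0 < a) {X : TangentSpace (𝓡 4) (ι q)}
    (hX : X = a • H.L (ι q)) (hXu : dReal u X = 0) (hXv : dReal v X = 1) (hXn : dSphere n X = 0)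
    (hXR : 0 ≤ dReal R X) (hOm : 0 ≤ Om (ι q)) (Y : TangentSpace (𝓡 2) q) :
    0 ≤ H.secondFF (ι q) (mfderiv (𝓡 2) (𝓡 4) ι q Y) (mfderiv (𝓡 2) (𝓡 4) ι q Y) := by
  set φ := extChartAt (𝓡 4) (ι q) with hφ
  set c := surfaceCurve ι q Y with hc_def
  have hc0 : c 0 = φ (ι q) := surfaceCurve_zero q Y
  have hc : ContDiffAt ℝ 2 c 0 := contDiffAt_surfaceCurve hι Y
  have hc' : deriv c 0 = mfderiv (𝓡 2) (𝓡 4) ι q Y := deriv_surfaceCurve hι Y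
  have hUn : U ∈ 𝓝 (ι q) := hU.mem_nhds hqU
  have hL : ContMDiffAt (𝓡 4) (𝓡 4).tangent 1
    (fun x ↦ (⟨x, H.L x⟩ : TangentBundle (𝓡 4) M)) (ι q) := H.contMDiffOn_L.contMDiffAt hUn
  have hlam : chartField H.L (ι q) (c 0) = H.L (ι q) := by rw [hc0]; exact chartField_self _ _
  have hct : Filter.Tendsto c (𝓝 0) (𝓝 (φ (ι q))) := by rw [← hc0]; exact hc.continuousAt
  have hsymm := symm_surfaceCurve hι Y
  have hpar := tendsto_surfaceParam q Y
  have hnhds : ∀ᶠ s in 𝓝 (0 : ℝ), ∀ᶠ t in 𝓝 s, H.f (φ.symm (c t)) = 0 := by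
    rw [eventually_eventually_nhds]
    filter_upwards [hsymm, hpar.eventually hf] with s h1 h2
    rw [hc_def, h1, h2]
  -- the null normal is orthogonal to the coordinate line at each of its points
  have horth : ∀ᶠ s in 𝓝 (0 : ℝ), doubleNullForm (Om ∘ φ.symm) (R ∘ φ.symm)
      (u ∘ φ.symm) (v ∘ φ.symm) ((fun q ↦ (n q : E3)) ∘ φ.symm) (c s)
      (chartField H.L (ι q) (c s)) (deriv c s) = 0 := by
    filter_upwards [hct.eventually h.coord_eq,
      hct.eventually ((isOpen_extChartAt_target _).mem_nhds (mem_extChartAt_target (I := 𝓡 4) _)),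
      hnhds, hct.eventually ((tendsto_extChartAt_symm (ι q)).eventually hUn),
      hc.eventually (by simp)] with s h1 h2 h3 h4 h5
    have hfs : MDifferentiableAt (𝓡 4) 𝓘(ℝ, ℝ) H.f (φ.symm (c s)) :=
      (H.contMDiffOn_f.contMDiffAt (hU.mem_nhds h4)).mdifferentiableAt (by norm_num)
    rw [← h1, LorentzMetric.coord, chartField, mfderiv_symm_mfderiv h2]
    refine H.normal _ h4 h3.self_of_nhds _ ?_
    rw [dReal_mfderiv_symm h2 hfs]
    have hfs' : DifferentiableAt ℝ (H.f ∘ φ.symm) (c s) := by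
      have := hfs.comp (c s)
        ((contMDiffAt_extChartAt_symm_of_mem_target h2).mdifferentiableAt (by simp))
      exact this.differentiableAt
    have hd := hfs'.hasFDerivAt.comp_hasDerivAt s
      (h5.differentiableAt (by norm_num)).hasDerivAt
    have h0 : HasDerivAt ((H.f ∘ φ.symm) ∘ c) 0 s :=
      (hasDerivAt_const s (0 : ℝ)).congr_of_eventuallyEq h3
    exact hd.unique h0
  have hu2 := ContMDiffAt.comp_extChartAt_symm (m := 2) h.contMDiffAt_u
  have hv2 := ContMDiffAt.comp_extChartAt_symm (m := 2) h.contMDiffAt_v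
  have hn2 := ContMDiffAt.comp_extChartAt_symm (m := 2) h.contMDiffAt_n
  have hOm2 := (ContMDiffAt.comp_extChartAt_symm (m := 1) h.contMDiffAt_Om).differentiableAt
    (by norm_num)
  have hR2 := (ContMDiffAt.comp_extChartAt_symm (m := 1) h.contMDiffAt_R).differentiableAt
    (by norm_num)
  have hl2 := differentiableAt_chartField hL
  rw [← hφ, ← hc0] at hu2 hv2 hn2 hOm2 hR2 hl2
  have hmin' : IsLocalMin ((u ∘ φ.symm) ∘ c) 0 := by
    filter_upwards [hsymm, hpar.eventually hmin] with s h1 h2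
    simp only [Function.comp_apply] at h2 ⊢
    rw [hc0, hφ, extChartAt_to_inv, ← hφ, hc_def, h1]
    exact h2
  have hcd := (hc.differentiableAt (by norm_num)).hasDerivAt
  have heu : fderiv ℝ (u ∘ φ.symm) (c 0) (deriv c 0) = 0 := by
    have hd := (hu2.differentiableAt (by norm_num)).hasFDerivAt.comp_hasDerivAt (0 : ℝ) hcd
    rw [← hd.deriv, hmin'.deriv_eq_zero]
  have h2nd : 0 ≤ deriv (deriv ((u ∘ φ.symm) ∘ c)) 0 :=
    hmin'.deriv_deriv_nonneg ((hu2.continuousAt).comp hcd.continuousAt)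
  rw [dReal_eq_fderiv (h.contMDiffAt_u.mdifferentiableAt (by norm_num)), hX, ← hφ] at hXu
  rw [dReal_eq_fderiv (h.contMDiffAt_v.mdifferentiableAt (by norm_num)), hX, ← hφ] at hXv
  rw [dSphere_eq_fderiv (h.contMDiffAt_n.mdifferentiableAt (by norm_num)), hX, ← hφ] at hXn
  rw [dReal_eq_fderiv (h.contMDiffAt_R.mdifferentiableAt (by norm_num)), hX, ← hφ] at hXR
  erw [← hc0, map_smul, ← hlam, smul_eq_mul] at hXu hXv hXR
  erw [← hc0, map_smul, ← hlam] at hXn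
  have hlu := (mul_eq_zero.1 hXu).resolve_left ha.ne'
  have hln := (smul_eq_zero.1 hXn).resolve_left ha.ne'
  have key := doubleNullForm_secondFF hOm2 hR2 hu2 hv2 hn2 hl2 hc horth hlu hln heu
  have hcoord : ∀ a b : E4, g.coord (ι q) a b =ᶠ[𝓝 (c 0)] fun y ↦ doubleNullForm (Om ∘ φ.symm)
      (R ∘ φ.symm) (u ∘ φ.symm) (v ∘ φ.symm) ((fun q ↦ (n q : E3)) ∘ φ.symm) y a b := fun a b ↦ by
    rw [hc0]; exact h.coord_eq.mono fun y hy ↦ hy a b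
  -- `covDeriv` and `christoffel` are computed in the preferred chart, where they only see the metric
  -- components near `ι q`
  have hsff : H.secondFF (ι q) (mfderiv (𝓡 2) (𝓡 4) ι q Y) (mfderiv (𝓡 2) (𝓡 4) ι q Y)
      = fderiv ℝ (R ∘ φ.symm) (c 0) (chartField H.L (ι q) (c 0)) / 2
          * ‖fderiv ℝ ((fun q ↦ (n q : E3)) ∘ φ.symm) (c 0) (deriv c 0)‖ ^ 2
        + (Om ∘ φ.symm) (c 0) / 2 * fderiv ℝ (v ∘ φ.symm) (c 0) (chartField H.L (ι q) (c 0))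
          * deriv (deriv ((u ∘ φ.symm) ∘ c)) 0 := by
    have e1 : g.val (ι q) (fderiv ℝ (chartField H.L (ι q)) (φ (ι q)) (mfderiv (𝓡 2) (𝓡 4) ι q Y))
        (mfderiv (𝓡 2) (𝓡 4) ι q Y) = doubleNullForm (Om ∘ φ.symm)
      (R ∘ φ.symm) (u ∘ φ.symm) (v ∘ φ.symm) ((fun q ↦ (n q : E3)) ∘ φ.symm) (c 0)
        (fderiv ℝ (chartField H.L (ι q)) (c 0) (deriv c 0)) (deriv c 0) := by
      rw [hc', hc0]; exact h.val_eq _ _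
    rw [← key, ← (hcoord _ _).fderiv_eq, ← (hcoord _ _).fderiv_eq, ← (hcoord _ _).fderiv_eq, ← e1,
      hlam, hc', hc0]
    rfl
  rw [hsff]
  have e1 : 0 ≤ fderiv ℝ (R ∘ φ.symm) (c 0) (chartField H.L (ι q) (c 0)) :=
    nonneg_of_mul_nonneg_right hXR ha
  have e2 : 0 ≤ fderiv ℝ (v ∘ φ.symm) (c 0) (chartField H.L (ι q) (c 0)) :=
    nonneg_of_mul_nonneg_right (hXv.symm ▸ zero_le_one) ha
  have e3 : 0 ≤ (Om ∘ φ.symm) (c 0) := by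
    rw [hc0, hφ, Function.comp_apply, extChartAt_to_inv]; exact hOm
  positivity

end SecondFF

/-! ### Surfaces at which a null coordinate is minimal -/

section Minimum

variable {M : Type*} [TopologicalSpace M] [ChartedSpace E4 M] [IsManifold (𝓡 4) ∞ M]
  {k : ℕ∞} {g : LorentzMetric k M} {τ : TimeOrientation g}
  {N : Type*} [TopologicalSpace N] [ChartedSpace (EuclideanSpace ℝ (Fin 2)) N] {ι : N → M}

theorem IsLocalMin.mfderiv_eq_zero {f : N → ℝ} {q : N} (h : IsLocalMin f q) :
    mfderiv (𝓡 2) 𝓘(ℝ, ℝ) f q = 0 := by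
  by_cases hf : MDifferentiableAt (𝓡 2) 𝓘(ℝ, ℝ) f q
  · rw [hf.mfderiv]
    simp only [ModelWithCorners.range_eq_univ, fderivWithin_univ]
    apply IsLocalMin.fderiv_eq_zero
    have ht := continuousAt_extChartAt_symm (I := 𝓡 2) q
    rw [ContinuousAt, extChartAt_to_inv] at ht
    filter_upwards [ht.eventually h] with y hy
    change f ((extChartAt (𝓡 2) q).symm (extChartAt (𝓡 2) q q))
      ≤ f ((extChartAt (𝓡 2) q).symm y)
    rwa [extChartAt_to_inv]
  · exact mfderiv_zero_of_not_mdifferentiableAt hf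

/-- A trapped surface has no point at which the null coordinate `u` is minimal and the area of the
symmetry spheres is nondecreasing in the direction `X = ∂_v`. -/
theorem IsTrappedSurface.not_isLocalMin [IsManifold (𝓡 2) 2 N] (hS : IsTrappedSurface g τ ι)
    {q : N} {u v : M → ℝ} {n : M → S2} {Om R : M → ℝ} (h : DoubleNullAt g (ι q) u v n Om R)
    {X : TangentSpace (𝓡 4) (ι q)} (hXu : dReal u X = 0) (hXv : dReal v X = 1)
    (hXn : dSphere n X = 0) (hXτ : τ.IsFuture X) (hXR : 0 ≤ dReal R X) (hOm : 0 ≤ Om (ι q)) :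
    ¬ IsLocalMin (u ∘ ι) q := by
  intro hmin
  obtain ⟨U, hU, hqU, H₁, H₂, hcar, hT⟩ := hS.trapped _ (mem_range_self q)
  obtain ⟨hli, hn₁, hn₂⟩ := hT (ι q) ⟨mem_range_self q, hqU⟩
  have hι := hS.contMDiff q
  have hιd : MDifferentiableAt (𝓡 2) (𝓡 4) ι q := hι.mdifferentiableAt (by norm_num)
  have hUn := hU.mem_nhds hqU
  have hcar' : ∀ᶠ q' in 𝓝 q, ι q' ∈ H₁.carrier ∩ H₂.carrier := by
    filter_upwards [hι.continuousAt hUn] with q' hq'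
    rw [← hcar]; exact ⟨mem_range_self q', hq'⟩
  have hf₁ : ∀ᶠ q' in 𝓝 q, H₁.f (ι q') = 0 := hcar'.mono fun q' hq' ↦ hq'.1.2
  have hf₂ : ∀ᶠ q' in 𝓝 q, H₂.f (ι q') = 0 := hcar'.mono fun q' hq' ↦ hq'.2.2
  have tangent : ∀ H : NullHypersurface g τ U, (∀ᶠ q' in 𝓝 q, H.f (ι q') = 0) →
      ∀ Y, dReal H.f (mfderiv (𝓡 2) (𝓡 4) ι q Y) = 0 := by
    intro H hf Y
    rw [dReal_mfderiv ((H.contMDiffOn_f.contMDiffAt hUn).mdifferentiableAt (by norm_num)) hιd,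
      IsLocalMin.mfderiv_eq_zero]
    · rfl
    · filter_upwards [hf] with q' hq'
      simp only [Function.comp_apply]
      rw [hq', hf.self_of_nhds]
  have hdu : ∀ Y, dReal u (mfderiv (𝓡 2) (𝓡 4) ι q Y) = 0 := by
    intro Y
    rw [dReal_mfderiv (h.contMDiffAt_u.mdifferentiableAt (by norm_num)) hιd, hmin.mfderiv_eq_zero]
    rfl
  have hdim₂ : Module.finrank ℝ (TangentSpace (𝓡 2) q) = 2 :=
    finrank_euclideanSpace_fin (𝕜 := ℝ) (n := 2)
  obtain ⟨Y₁, Y₂, h11, h22, h12⟩ := exists_orthonormal_pair hdim₂.ge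
    (fun Y Z ↦ g.val (ι q) (mfderiv (𝓡 2) (𝓡 4) ι q Y) (mfderiv (𝓡 2) (𝓡 4) ι q Z))
    (fun Y Z ↦ g.symm _ _ _) (fun _ _ _ ↦ by rw [map_add, map_add, add_apply])
    (fun _ _ _ ↦ by rw [map_smul, map_smul, smul_apply, smul_eq_mul]) (hS.spacelike q)
  have metricX : ∀ Y, g.val (ι q) X Y = - Om (ι q) / 2 * dReal u Y := by
    intro Y
    rw [h.metric.self_of_nhds, hXu, hXv, hXn]; simp
  have hFD : FiniteDimensional ℝ (TangentSpace (𝓡 4) (ι q)) :=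
    inferInstanceAs (FiniteDimensional ℝ E4)
  have hdim : Module.finrank ℝ (TangentSpace (𝓡 4) (ι q)) = 4 :=
    finrank_euclideanSpace_fin (𝕜 := ℝ) (n := 4)
  have zero : ∀ H : NullHypersurface g τ U, (∀ᶠ q' in 𝓝 q, H.f (ι q') = 0) →
      H.f (ι q) = 0 := fun H hf ↦ hf.self_of_nhds
  have hor₁ := fun Y ↦ H₁.normal _ hqU (zero H₁ hf₁) _ (tangent H₁ hf₁ Y)
  have hor₂ := fun Y ↦ H₂.normal _ hqU (zero H₂ hf₂) _ (tangent H₂ hf₂ Y)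
  rcases null_normal_proportional hdim (g.symm (ι q))
    (g.lorentzian (ι q)) (τ.timelike (ι q)) ((metricX X).trans (by rw [hXu, mul_zero])) hXτ.2.2
    (H₁.null _ hqU (zero H₁ hf₁)) (H₁.future _ hqU (zero H₁ hf₁)).2.2
    (H₂.null _ hqU (zero H₂ hf₂)) (H₂.future _ hqU (zero H₂ hf₂)).2.2 hli h11 h22 h12
    ((metricX _).trans (by rw [hdu, mul_zero])) ((metricX _).trans (by rw [hdu, mul_zero]))
    (hor₁ Y₁) (hor₁ Y₂) (hor₂ Y₁) (hor₂ Y₂) with ⟨a, ha, hXa⟩ | ⟨a, ha, hXa⟩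
  · have nn := h.secondFF_nonneg hU hqU H₁ hι hf₁ hmin ha hXa hXu hXv hXn hXR hOm
    have neg := hn₁ _ _ (tangent H₁ hf₁ Y₁) (tangent H₁ hf₁ Y₂) h11 h22 h12
    linarith [nn Y₁, nn Y₂]
  · have nn := h.secondFF_nonneg hU hqU H₂ hι hf₂ hmin ha hXa hXu hXv hXn hXR hOm
    have neg := hn₂ _ _ (tangent H₂ hf₂ Y₁) (tangent H₂ hf₂ Y₂) h11 h22 h12
    linarith [nn Y₁, nn Y₂]

end Minimum

/-! ### Double null coordinates off the center -/

namespace SphericallySymmetric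

variable {M : Type*} [TopologicalSpace M] [ChartedSpace E4 M] [IsManifold (𝓡 4) ∞ M]
  {k : ℕ∞} {g : LorentzMetric k M} {τ : TimeOrientation g} (D : SphericallySymmetric g τ)

theorem isOpen_offCenter : IsOpen {p : M | (D.u p, D.v p) ∉ D.axis} := by
  have h := D.isOpen_interior.preimage (D.continuous_u.prodMk D.continuous_v)
  convert h using 1
  ext p
  simp [D.mem_Q p]

theorem mem_nhds_offCenter {p : M} (hp : (D.u p, D.v p) ∉ D.axis) :
    {p : M | (D.u p, D.v p) ∉ D.axis} ∈ 𝓝 p := D.isOpen_offCenter.mem_nhds hp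

theorem two_le_add_one (hk : 1 ≤ k) : (2 : WithTop ℕ∞) ≤ (k : WithTop ℕ∞) + 1 := by
  have h : (1 : WithTop ℕ∞) ≤ k := by exact_mod_cast hk
  calc (2 : WithTop ℕ∞) = 1 + 1 := by norm_num
    _ ≤ k + 1 := by gcongr

theorem Q_mem_nhds {z : ℝ × ℝ} (hz : z ∈ D.Q \ D.axis) : D.Q ∈ 𝓝 z :=
  Filter.mem_of_superset (D.isOpen_interior.mem_nhds hz) sdiff_subset

variable (hk : 1 ≤ k) {p : M} (hp : (D.u p, D.v p) ∉ D.axis)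
include hk hp

theorem contMDiffAt_u : ContMDiffAt (𝓡 4) 𝓘(ℝ, ℝ) 2 D.u p :=
  (D.contMDiffOn_u.contMDiffAt (D.mem_nhds_offCenter hp)).of_le (two_le_add_one hk)

theorem contMDiffAt_v : ContMDiffAt (𝓡 4) 𝓘(ℝ, ℝ) 2 D.v p :=
  (D.contMDiffOn_v.contMDiffAt (D.mem_nhds_offCenter hp)).of_le (two_le_add_one hk)

theorem contMDiffAt_angle : ContMDiffAt (𝓡 4) 𝓘(ℝ, E3) 2 (fun q ↦ (D.angle q : E3)) p :=
  have : Fact (Module.finrank ℝ E3 = 2 + 1) := ⟨finrank_euclideanSpace_fin⟩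
  (contMDiff_coe_sphere (n := 2) (E := E3)).contMDiffAt.comp p
    ((D.contMDiffOn_angle.contMDiffAt (D.mem_nhds_offCenter hp)).of_le (two_le_add_one hk))

theorem contDiffAt_r : ContDiffAt ℝ 1 D.r (D.u p, D.v p) :=
  (D.contDiffOn_r.contDiffAt (D.Q_mem_nhds ⟨D.mem_Q p, hp⟩)).of_le (by exact_mod_cast hk)

theorem contDiffAt_OmegaSq : ContDiffAt ℝ 1 D.OmegaSq (D.u p, D.v p) :=
  (D.contDiffOn_OmegaSq.contDiffAt (D.Q_mem_nhds ⟨D.mem_Q p, hp⟩)).of_le (by exact_mod_cast hk)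

theorem contMDiffAt_uv : ContMDiffAt (𝓡 4) 𝓘(ℝ, ℝ × ℝ) 2 (fun q ↦ (D.u q, D.v q)) p :=
  (D.contMDiffAt_u hk hp).prodMk_space (D.contMDiffAt_v hk hp)

theorem doubleNullAt : DoubleNullAt g p D.u D.v D.angle (fun q ↦ D.OmegaSq (D.u q, D.v q))
    (fun q ↦ D.r (D.u q, D.v q) ^ 2) where
  contMDiffAt_u := D.contMDiffAt_u hk hp
  contMDiffAt_v := D.contMDiffAt_v hk hp
  contMDiffAt_n := D.contMDiffAt_angle hk hp
  contMDiffAt_Om := (D.contDiffAt_OmegaSq hk hp).contMDiffAt.comp p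
    ((D.contMDiffAt_uv hk hp).of_le (by norm_num))
  contMDiffAt_R := ((D.contDiffAt_r hk hp).pow 2).contMDiffAt.comp p
    ((D.contMDiffAt_uv hk hp).of_le (by norm_num))
  metric := by
    filter_upwards [D.mem_nhds_offCenter hp] with q hq using D.metric q hq

theorem dReal_r_sq (X : TangentSpace (𝓡 4) p) :
    dReal (fun q ↦ D.r (D.u q, D.v q) ^ 2) X
      = 2 * D.r (D.u p, D.v p) *
        fderivWithin ℝ D.r D.Q (D.u p, D.v p) (dReal D.u X, dReal D.v X) := by
  rw [fderivWithin_of_mem_nhds (D.Q_mem_nhds ⟨D.mem_Q p, hp⟩)]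
  have hr := ((D.contDiffAt_r hk hp).differentiableAt (by norm_num)).hasFDerivAt.pow 2
  have huv := ((D.contMDiffAt_uv hk hp).mdifferentiableAt (by norm_num)).hasMFDerivAt
  have eu := (HasMFDerivAt.comp (I' := 𝓘(ℝ, ℝ × ℝ)) p (hasFDerivAt_fst (𝕜 := ℝ) (E := ℝ) (F := ℝ)
    (p := (D.u p, D.v p))).hasMFDerivAt huv).mfderiv
  have ev := (HasMFDerivAt.comp (I' := 𝓘(ℝ, ℝ × ℝ)) p (hasFDerivAt_snd (𝕜 := ℝ) (E := ℝ) (F := ℝ)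
    (p := (D.u p, D.v p))).hasMFDerivAt huv).mfderiv
  have h := (HasMFDerivAt.comp (I' := 𝓘(ℝ, ℝ × ℝ)) (g := fun z ↦ D.r z ^ 2) p hr.hasMFDerivAt
    huv).mfderiv
  have hX : (dReal D.u X, dReal D.v X)
      = mfderiv (𝓡 4) 𝓘(ℝ, ℝ × ℝ) (fun q ↦ (D.u q, D.v q)) p X :=
    Prod.ext congr($eu X) congr($ev X)
  rw [hX, dReal]
  refine Eq.trans congr($h X) ?_
  change (2 • D.r (D.u p, D.v p) ^ (2 - 1)) * _ = _
  simp

omit hp in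
/-- The coordinate vector fields: a vector of the `(u, v)`-plane lifts to a tangent vector of `M`,
horizontally with respect to the product structure. -/
theorem lift_point {z : ℝ × ℝ} (hz : z ∈ D.Q \ D.axis) (θ : S2) :
    ∃ A : (ℝ × ℝ) →L[ℝ] TangentSpace (𝓡 4) (D.point (z, θ)),
      HasMFDerivAt 𝓘(ℝ, ℝ × ℝ) (𝓡 4) (fun w ↦ D.point (w, θ)) z A ∧ ∀ w,
      dReal D.u (A w) = w.1 ∧ dReal D.v (A w) = w.2 ∧ dSphere D.angle (A w) = 0 := by
  have hp : (D.u (D.point (z, θ)), D.v (D.point (z, θ))) ∉ D.axis := by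
    rw [D.coord_point z hz.1]; exact hz.2
  have hpt : ContMDiffAt 𝓘(ℝ, ℝ × ℝ) (𝓡 4) 2 (fun w ↦ D.point (w, θ)) z := by
    have h1 : ContMDiffAt (𝓘(ℝ, ℝ × ℝ).prod (𝓡 2)) (𝓡 4) 2 D.point (z, θ) :=
      (D.contMDiffOn_point.contMDiffAt ((D.isOpen_interior.prod isOpen_univ).mem_nhds
        ⟨hz, mem_univ θ⟩)).of_le (two_le_add_one hk)
    exact h1.comp z (contMDiffAt_id.prodMk contMDiffAt_const)
  have hA := (hpt.mdifferentiableAt (by norm_num)).hasMFDerivAt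
  have hnear := D.isOpen_interior.mem_nhds hz
  refine ⟨_, hA, fun w ↦ ⟨?_, ?_, ?_⟩⟩
  · have h1 := ((D.contMDiffAt_u hk hp).mdifferentiableAt (by norm_num)).hasMFDerivAt.comp z hA
    have h2 : HasMFDerivAt 𝓘(ℝ, ℝ × ℝ) 𝓘(ℝ, ℝ) (D.u ∘ fun w ↦ D.point (w, θ)) z
        (ContinuousLinearMap.fst ℝ ℝ ℝ) := by
      refine hasFDerivAt_fst.hasMFDerivAt.congr_of_eventuallyEq ?_
      filter_upwards [hnear] with w hw using congr($(D.coord_point w hw.1 θ).1)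
    exact congr($(hasMFDerivAt_unique h1 h2) w)
  · have h1 := ((D.contMDiffAt_v hk hp).mdifferentiableAt (by norm_num)).hasMFDerivAt.comp z hA
    have h2 : HasMFDerivAt 𝓘(ℝ, ℝ × ℝ) 𝓘(ℝ, ℝ) (D.v ∘ fun w ↦ D.point (w, θ)) z
        (ContinuousLinearMap.snd ℝ ℝ ℝ) := by
      refine hasFDerivAt_snd.hasMFDerivAt.congr_of_eventuallyEq ?_
      filter_upwards [hnear] with w hw using congr($(D.coord_point w hw.1 θ).2)
    exact congr($(hasMFDerivAt_unique h1 h2) w)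
  · have h1 := ((D.contMDiffAt_angle hk hp).mdifferentiableAt (by norm_num)).hasMFDerivAt.comp z hA
    have h2 : HasMFDerivAt 𝓘(ℝ, ℝ × ℝ) 𝓘(ℝ, E3)
        ((fun q ↦ (D.angle q : E3)) ∘ fun w ↦ D.point (w, θ)) z 0 := by
      refine (hasMFDerivAt_const (θ : E3) z).congr_of_eventuallyEq ?_
      filter_upwards [hnear] with w hw
      exact congrArg Subtype.val (D.angle_point w hw θ)
    exact congr($(hasMFDerivAt_unique h1 h2) w)

theorem exists_lift (w : ℝ × ℝ) : ∃ X : TangentSpace (𝓡 4) p,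
    dReal D.u X = w.1 ∧ dReal D.v X = w.2 ∧ dSphere D.angle X = 0 := by
  have key : ∀ q, D.point ((D.u p, D.v p), D.angle p) = q → ∃ X : TangentSpace (𝓡 4) q,
      dReal D.u X = w.1 ∧ dReal D.v X = w.2 ∧ dSphere D.angle X = 0 := by
    rintro _ rfl
    obtain ⟨A, -, hA⟩ := D.lift_point hk ⟨D.mem_Q p, hp⟩ (D.angle p)
    exact ⟨A w, hA w⟩
  exact key p (D.point_coord p)

end SphericallySymmetric

/-! ### Minima of `u` at the center -/

section Cone

variable {M : Type*} [TopologicalSpace M] [ChartedSpace E4 M] [IsManifold (𝓡 4) ∞ M]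
  {k : ℕ∞} {g : LorentzMetric k M} {τ : TimeOrientation g}

theorem LorentzMetric.continuous_tangentBundle (g : LorentzMetric k M)
    {V W : ∀ ξ : TangentBundle (𝓡 4) M, TangentSpace (𝓡 4) ξ.proj}
    (hV : Continuous fun ξ ↦ (⟨ξ.proj, V ξ⟩ : TangentBundle (𝓡 4) M))
    (hW : Continuous fun ξ ↦ (⟨ξ.proj, W ξ⟩ : TangentBundle (𝓡 4) M)) :
    Continuous fun ξ ↦ g.val ξ.proj (V ξ) (W ξ) := by
  have : IsManifold (𝓡 4) 1 M := IsManifold.of_le (n := ∞) (by exact_mod_cast le_top)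
  have h : ContMDiff (𝓡 4).tangent ((𝓡 4).prod 𝓘(ℝ)) 0
      (fun ξ : TangentBundle (𝓡 4) M ↦ Bundle.TotalSpace.mk' ℝ (E := Bundle.Trivial M ℝ) ξ.proj
        (g.val ξ.proj (V ξ) (W ξ))) := by
    apply ContMDiff.clm_bundle_apply₂ (F₁ := E4) (F₂ := E4)
    · exact (g.contMDiff.of_le (by simp)).comp
        (contMDiff_zero_iff.2 (FiberBundle.continuous_proj E4 (TangentSpace (𝓡 4) (M := M))))
    · exact contMDiff_zero_iff.2 hV
    · exact contMDiff_zero_iff.2 hW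
  exact continuous_iff_continuousAt.2 fun ξ ↦
    ((Bundle.contMDiffAt_totalSpace.1 (h ξ)).2).continuousAt

/-- If `W` is a future-directed timelike vector at `p`, the linear function `g_p(W, ·)` of the
preferred coordinates at `p` is negative on future-directed causal vectors at all points near `p`.
At `p` this is the reversed Cauchy–Schwarz inequality, and it persists nearby by compactness of the
unit sphere of directions. -/
theorem TimeOrientation.eventually_neg_of_isFuture (τ : TimeOrientation g) {p : M}
    {W : TangentSpace (𝓡 4) p} (hW : g.val p W W < 0) (hτW : g.val p (τ.vec p) W < 0) :
    ∀ᶠ y in 𝓝 p, ∀ X : TangentSpace (𝓡 4) y, τ.IsFuture X →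
      g.val p W (mfderiv (𝓡 4) 𝓘(ℝ, E4) (extChartAt (𝓡 4) p) y X : E4) < 0 := by
  have : IsManifold (𝓡 4) 1 M := IsManifold.of_le (n := ∞) (by exact_mod_cast le_top)
  set e := trivializationAt E4 (TangentSpace (𝓡 4) (M := M)) p with he
  have hbase : ∀ y, y ∈ e.baseSet ↔ y ∈ (chartAt E4 p).source := by simp [he]
  have hp : p ∈ e.baseSet := (hbase p).2 (mem_chart_source E4 p)
  have hF₁ : Continuous fun ξ : TangentBundle (𝓡 4) M ↦ g.val ξ.proj ξ.2 ξ.2 :=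
    g.continuous_tangentBundle continuous_id continuous_id
  have hF₂ : Continuous fun ξ : TangentBundle (𝓡 4) M ↦ g.val ξ.proj (τ.vec ξ.proj) ξ.2 :=
    g.continuous_tangentBundle (τ.continuous.comp (FiberBundle.continuous_proj E4 _)) continuous_id
  have hid : ∀ ξ : E4, e.symm p ξ = ξ := by
    intro ξ
    have h1 := e.symmL_continuousLinearMapAt (R := ℝ) hp (ξ : TangentSpace (𝓡 4) p)
    have h2 := congr($(TangentBundle.continuousLinearMapAt_trivializationAt (𝕜 := ℝ)
      (I := 𝓡 4) (mem_chart_source E4 p)) (ξ : TangentSpace (𝓡 4) p))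
    rw [mfderiv_extChartAt_self] at h2
    rw [← e.symmL_apply (R := ℝ) hp]
    exact (congrArg (e.symmL ℝ p) h2.symm).trans h1
  have key : ∀ᶠ y in 𝓝 p, ∀ ξ ∈ Metric.sphere (0 : E4) 1,
      (0 < g.val y (e.symm y ξ) (e.symm y ξ) ∨ 0 < g.val y (τ.vec y) (e.symm y ξ))
        ∨ g.val p W ξ < 0 := by
    refine (isCompact_sphere (0 : E4) 1).eventually_forall_of_forall_eventually fun ξ hξ ↦ ?_
    have hS : ContinuousAt (fun z : M × E4 ↦ (⟨z.1, e.symm z.1 z.2⟩ : TangentBundle (𝓡 4) M))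
        (p, ξ) := e.continuousOn_symm.continuousAt
          ((e.open_baseSet.prod isOpen_univ).mem_nhds ⟨hp, mem_univ _⟩)
    have hξ0 : (ξ : TangentSpace (𝓡 4) p) ≠ (0 : E4) := by
      rintro rfl; simp at hξ
    have h0 : (0 < g.val p (e.symm p ξ) (e.symm p ξ) ∨ 0 < g.val p (τ.vec p) (e.symm p ξ))
        ∨ g.val p W ξ < 0 := by
      rw [hid]
      by_contra! hcon
      exact absurd (neg_of_causal_of_timelike (g.symm p) (g.lorentzian p) (τ.timelike p) hW hτW
        hξ0 hcon.1.1 hcon.1.2) (not_lt.2 hcon.2)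
    have hWc : Continuous fun z : M × E4 ↦ g.val p W z.2 :=
      (g.val p W).continuous.comp continuous_snd
    rcases h0 with (h0 | h0) | h0
    · filter_upwards [(hF₁.continuousAt.comp hS).eventually (lt_mem_nhds h0)] with z hz
      exact .inl (.inl hz)
    · filter_upwards [(hF₂.continuousAt.comp hS).eventually (lt_mem_nhds h0)] with z hz
      exact .inl (.inr hz)
    · filter_upwards [hWc.continuousAt.eventually (gt_mem_nhds h0)] with z hz
      exact .inr hz
  filter_upwards [key, e.open_baseSet.mem_nhds hp] with y hy hyb X hX
  have hcl := congr($(TangentBundle.continuousLinearMapAt_trivializationAt (𝕜 := ℝ)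
      (I := 𝓡 4) ((hbase y).1 hyb)) X)
  set ξ : E4 := mfderiv (𝓡 4) 𝓘(ℝ, E4) (extChartAt (𝓡 4) p) y X with hξ
  have hsymm : e.symmL ℝ y ξ = X :=
    (congrArg (e.symmL ℝ y) hcl.symm).trans (e.symmL_continuousLinearMapAt (R := ℝ) hyb X)
  have hξ0 : ξ ≠ 0 := by
    intro h; rw [h, map_zero] at hsymm; exact hX.1 hsymm.symm
  have hn : 0 < ‖ξ‖⁻¹ := inv_pos.2 (norm_pos_iff.2 hξ0)
  have h := hy (‖ξ‖⁻¹ • ξ) (by simp [norm_smul, hξ0])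
  rw [← e.symmL_apply (R := ℝ) hyb, map_smul, hsymm] at h
  simp only [map_smul, smul_apply, smul_eq_mul] at h
  rcases h with (h | h) | h
  · have := mul_nonpos_of_nonneg_of_nonpos hn.le
      (mul_nonpos_of_nonneg_of_nonpos hn.le hX.2.1)
    linarith
  · have := mul_neg_of_pos_of_neg hn hX.2.2
    linarith
  · have h : ‖ξ‖⁻¹ * g.val p W ξ < 0 := by
      have h1 := (g.val p W).map_smul ‖ξ‖⁻¹ ξ
      rw [smul_eq_mul] at h1
      exact h1 ▸ h
    exact neg_of_mul_neg_right h hn.le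

end Cone

namespace SphericallySymmetric

variable {M : Type*} [TopologicalSpace M] [ChartedSpace E4 M] [IsManifold (𝓡 4) ∞ M]
  {k : ℕ∞} {g : LorentzMetric k M} {τ : TimeOrientation g} (D : SphericallySymmetric g τ)

/-- A function that is nondecreasing in future causal directions does not decrease along a path in
`Q` with constant coordinate velocity `d`, lifted to `M` at a fixed angle, if the horizontal lift of
`d` is future-directed. The endpoints of the path may lie on the axis. -/
theorem le_of_future_path (hk : 1 ≤ k) {f : M → ℝ} {O : Set M}
    (hO : ∀ y ∈ O, MDifferentiableAt (𝓡 4) 𝓘(ℝ, ℝ) f y ∧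
      ∀ X : TangentSpace (𝓡 4) y, τ.IsFuture X → 0 ≤ dReal f X)
    {d : ℝ × ℝ} (hd : ∀ p : M, (D.u p, D.v p) ∉ D.axis → ∀ X : TangentSpace (𝓡 4) p,
      dReal D.u X = d.1 → dReal D.v X = d.2 → dSphere D.angle X = 0 → τ.IsFuture X)
    {c : ℝ → ℝ × ℝ} (hc : ∀ s, HasDerivAt c d s) {a b : ℝ} (hab : a ≤ b) (θ : S2)
    (hQ : ∀ s ∈ Icc a b, c s ∈ D.Q ∧ D.point (c s, θ) ∈ O)
    (hQ' : ∀ s ∈ Ioo a b, c s ∈ D.Q \ D.axis) :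
    f (D.point (c a, θ)) ≤ f (D.point (c b, θ)) := by
  have hcont : ContinuousOn (fun s ↦ f (D.point (c s, θ))) (Icc a b) := by
    have h1 : ContinuousOn (fun s ↦ D.point (c s, θ)) (Icc a b) :=
      D.continuousOn_point.comp (t := D.Q ×ˢ univ) (f := fun s ↦ (c s, θ))
        (fun s _ ↦ ((hc s).continuousAt.prodMk continuousAt_const).continuousWithinAt)
        (fun s hs ↦ ⟨(hQ s hs).1, mem_univ _⟩)
    exact fun s hs ↦ (hO _ (hQ s hs).2).1.continuousAt.comp_continuousWithinAt
      (f := fun s ↦ D.point (c s, θ)) (h1 s hs)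
  have hder : ∀ s ∈ Ioo a b, ∃ f' : ℝ, 0 ≤ f' ∧
      HasDerivAt (fun s ↦ f (D.point (c s, θ))) f' s := by
    intro s hs
    obtain ⟨A, hA, hA'⟩ := D.lift_point hk (hQ' s hs) θ
    obtain ⟨h1, h2⟩ := hO _ (hQ s (Ioo_subset_Icc_self hs)).2
    obtain ⟨e1, e2, e3⟩ := hA' d
    have hoff : (D.u (D.point (c s, θ)), D.v (D.point (c s, θ))) ∉ D.axis := by
      rw [D.coord_point _ (hQ' s hs).1]; exact (hQ' s hs).2
    refine ⟨dReal f (A d), h2 _ (hd _ hoff _ e1 e2 e3), ?_⟩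
    have h3 := (HasMFDerivAt.comp (c s) h1.hasMFDerivAt hA).hasFDerivAt
    exact h3.comp_hasDerivAt s (hc s)
  refine monotoneOn_of_deriv_nonneg (convex_Icc a b) hcont (fun s hs ↦ ?_) (fun s hs ↦ ?_)
    (left_mem_Icc.2 hab) (right_mem_Icc.2 hab) hab
  · rw [interior_Icc] at hs
    obtain ⟨f', -, hf'⟩ := hder s hs
    exact hf'.differentiableAt.differentiableWithinAt
  · rw [interior_Icc] at hs
    obtain ⟨f', h0, hf'⟩ := hder s hs
    rw [hf'.deriv]; exact h0

/-- Near a point `p` of the center, the points with `u ≥ u p` lie to the future of `p`: they are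
reached by following `∂_v` from `p`, then `∂_u`. Hence a function that is nondecreasing in future
causal directions has a local minimum at `p` among them. -/
theorem eventually_le_of_mem_axis (hk : 1 ≤ k) {p : M} (hp : (D.u p, D.v p) ∈ D.axis) {f : M → ℝ}
    (hf : ∀ᶠ y in 𝓝 p, MDifferentiableAt (𝓡 4) 𝓘(ℝ, ℝ) f y ∧
      ∀ X : TangentSpace (𝓡 4) y, τ.IsFuture X → 0 ≤ dReal f X) :
    ∀ᶠ y in 𝓝 p, D.u p ≤ D.u y → f p ≤ f y := by
  set O := {y | MDifferentiableAt (𝓡 4) 𝓘(ℝ, ℝ) f y ∧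
      ∀ X : TangentSpace (𝓡 4) y, τ.IsFuture X → 0 ≤ dReal f X}
  have hpoint : ∀ θ, D.point ((D.u p, D.v p), θ) = p := fun θ ↦
    (D.point_axis _ hp θ (D.angle p)).trans (D.point_coord p)
  -- the spheres over points of `Q` near the projection of `p` are contained in `O`
  have hbox : ∀ᶠ z in 𝓝 (D.u p, D.v p), ∀ θ ∈ (univ : Set S2), z ∈ D.Q → D.point (z, θ) ∈ O := by
    refine isCompact_univ.eventually_forall_of_forall_eventually fun θ _ ↦ ?_
    have h1 := D.continuousOn_point ((D.u p, D.v p), θ) ⟨D.mem_Q p, mem_univ θ⟩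
    rw [ContinuousWithinAt, hpoint θ] at h1
    filter_upwards [eventually_nhdsWithin_iff.1 (h1.eventually hf)] with z hz hzQ
    exact hz ⟨hzQ, mem_univ _⟩
  obtain ⟨V, hV, h, hh, hh', hVQ⟩ := D.boundary _ hp
  have hh2 : ContDiffAt ℝ 2 h (D.u p) := hh.of_le (two_le_add_one hk)
  have hder : ∀ᶠ a in 𝓝 (D.u p), 0 < deriv h a := by
    have hc : ContinuousAt (deriv h) (D.u p) :=
      ((hh2.fderiv_right (m := 1) (by norm_num)).clm_apply contDiffAt_const).continuousAt
    exact hc.eventually (lt_mem_nhds hh')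
  have hdiff : ∀ᶠ a in 𝓝 (D.u p), ContinuousAt h a :=
    (hh2.eventually (by simp)).mono fun a ha ↦ ha.continuousAt
  have hfst : Filter.Tendsto Prod.fst (𝓝 (D.u p, D.v p)) (𝓝 (D.u p)) :=
    continuous_fst.continuousAt
  obtain ⟨ε, hε, hball⟩ := Metric.eventually_nhds_iff.1
    (hbox.and (Filter.Eventually.and hV ((hfst.eventually hder).and (hfst.eventually hdiff))))
  have hball' : ∀ a b, |a - D.u p| < ε → |b - D.v p| < ε → _ := fun a b ha hb ↦
    hball (y := (a, b)) (by rw [Prod.dist_eq]; exact max_lt ha hb)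
  have hself : |D.u p - D.u p| < ε := by simpa using hε
  have hself' : |D.v p - D.v p| < ε := by simpa using hε
  have hh0 : D.v p = h (D.u p) := (hVQ _ (mem_of_mem_nhds hV)).2.1 hp
  have eu := D.continuous_u.continuousAt.eventually (Metric.ball_mem_nhds (D.u p) hε)
  have ev := D.continuous_v.continuousAt.eventually (Metric.ball_mem_nhds (D.v p) hε)
  filter_upwards [eu, ev] with y hyu hyv huy
  rw [Real.dist_eq] at hyu hyv
  have inbox : ∀ a ∈ Icc (D.u p) (D.u y), |a - D.u p| < ε := by
    intro a ha
    rw [abs_of_nonneg (sub_nonneg.2 ha.1)]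
    rw [abs_of_nonneg (sub_nonneg.2 huy)] at hyu
    linarith [ha.2]
  have hmono : StrictMonoOn h (Icc (D.u p) (D.u y)) := by
    refine strictMonoOn_of_deriv_pos (convex_Icc _ _) (fun a ha ↦ ?_) (fun a ha ↦ ?_)
    · exact (hball' a _ (inbox a ha) hself').2.2.2.continuousWithinAt
    · exact (hball' a _ (inbox a (interior_subset ha)) hself').2.2.1
  have hhy : h (D.u y) ≤ D.v y := ((hVQ _ (hball' _ _ hyu hyv).2.1).1).1 (D.mem_Q y)
  have hle : h (D.u p) ≤ h (D.u y) :=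
    hmono.monotoneOn (left_mem_Icc.2 huy) (right_mem_Icc.2 huy) huy
  have hv : D.v p ≤ D.v y := by linarith
  have inbox' : ∀ b ∈ Icc (D.v p) (D.v y), |b - D.v p| < ε := by
    intro b hb
    rw [abs_of_nonneg (sub_nonneg.2 hb.1)]
    rw [abs_of_nonneg (sub_nonneg.2 hv)] at hyv
    linarith [hb.2]
  have step₁ : f (D.point ((D.u p, D.v p), D.angle y))
      ≤ f (D.point ((D.u p, D.v y), D.angle y)) := by
    refine D.le_of_future_path hk (O := O) (fun y hy ↦ hy) (d := (0, 1)) D.future_v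
      (c := fun s ↦ (D.u p, s)) (fun s ↦ (hasDerivAt_const s _).prodMk (hasDerivAt_id s)) hv
      (D.angle y) (fun s hs ↦ ?_) (fun s hs ↦ ?_)
    · have hb := hball' _ s hself (inbox' s hs)
      have hsQ : (D.u p, s) ∈ D.Q := ((hVQ _ hb.2.1).1).2 (hh0 ▸ hs.1)
      exact ⟨hsQ, hb.1 _ (mem_univ _) hsQ⟩
    · have hb := hball' _ s hself (inbox' s (Ioo_subset_Icc_self hs))
      refine ⟨((hVQ _ hb.2.1).1).2 (hh0 ▸ hs.1.le), fun hax ↦ ?_⟩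
      have h1 : s = h (D.u p) := ((hVQ _ hb.2.1).2).1 hax
      linarith [hs.1]
  have step₂ : f (D.point ((D.u p, D.v y), D.angle y))
      ≤ f (D.point ((D.u y, D.v y), D.angle y)) := by
    refine D.le_of_future_path hk (O := O) (fun y hy ↦ hy) (d := (1, 0)) D.future_u
      (c := fun s ↦ (s, D.v y)) (fun s ↦ (hasDerivAt_id s).prodMk (hasDerivAt_const s _)) huy
      (D.angle y) (fun s hs ↦ ?_) (fun s hs ↦ ?_)
    · have hb := hball' s _ (inbox s hs) hyv
      have h1 := hmono.monotoneOn hs (right_mem_Icc.2 huy) hs.2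
      have hsQ : (s, D.v y) ∈ D.Q := ((hVQ _ hb.2.1).1).2 (h1.trans hhy)
      exact ⟨hsQ, hb.1 _ (mem_univ _) hsQ⟩
    · have hb := hball' s _ (inbox s (Ioo_subset_Icc_self hs)) hyv
      have h1 := hmono (Ioo_subset_Icc_self hs) (right_mem_Icc.2 huy) hs.2
      refine ⟨((hVQ _ hb.2.1).1).2 (h1.le.trans hhy), fun hax ↦ ?_⟩
      have h2 : D.v y = h s := ((hVQ _ hb.2.1).2).1 hax
      linarith
  rw [hpoint] at step₁
  rw [D.point_coord] at step₂
  exact step₁.trans step₂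

/-- On a spacelike surface, `u` has no local minimum at the center: all linear functions
`-g(W, ·)` with `W` timelike and future-directed would be stationary on the surface, whereas a
tangent plane cannot be orthogonal to all such `W`. -/
theorem not_isLocalMin_of_mem_axis (hk : 1 ≤ k) {N : Type*} [TopologicalSpace N]
    [ChartedSpace (EuclideanSpace ℝ (Fin 2)) N] {ι : N → M} {q : N}
    (hι : MDifferentiableAt (𝓡 2) (𝓡 4) ι q)
    (hsp : ∀ X : TangentSpace (𝓡 2) q, X ≠ 0 →
      0 < g.val (ι q) (mfderiv (𝓡 2) (𝓡 4) ι q X) (mfderiv (𝓡 2) (𝓡 4) ι q X))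
    (hq : (D.u (ι q), D.v (ι q)) ∈ D.axis) : ¬ IsLocalMin (D.u ∘ ι) q := by
  have : IsManifold (𝓡 4) 1 M := IsManifold.of_le (n := ∞) (by exact_mod_cast le_top)
  intro hmin
  have key : ∀ W : TangentSpace (𝓡 4) (ι q), g.val (ι q) W W < 0 →
      g.val (ι q) (τ.vec (ι q)) W < 0 →
      ∀ Y, g.val (ι q) W (mfderiv (𝓡 2) (𝓡 4) ι q Y) = 0 := by
    intro W hW hτW Y
    set ℓ : E4 →L[ℝ] ℝ := -g.val (ι q) W with hℓ
    have hder : ∀ y ∈ (chartAt E4 (ι q)).source,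
        HasMFDerivAt (𝓡 4) 𝓘(ℝ, ℝ) (ℓ ∘ extChartAt (𝓡 4) (ι q)) y
          (ℓ ∘L mfderiv (𝓡 4) 𝓘(ℝ, E4) (extChartAt (𝓡 4) (ι q)) y) := fun y hy ↦
      ℓ.hasFDerivAt.hasMFDerivAt.comp y
        (mdifferentiableAt_extChartAt (I := 𝓡 4) hy).hasMFDerivAt
    have hsrc := (chartAt E4 (ι q)).open_source.mem_nhds (mem_chart_source E4 (ι q))
    have hle := D.eventually_le_of_mem_axis hk hq (f := ℓ ∘ extChartAt (𝓡 4) (ι q)) (by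
      filter_upwards [hsrc, τ.eventually_neg_of_isFuture hW hτW] with y hy h1
      refine ⟨(hder y hy).mdifferentiableAt, fun X hX ↦ ?_⟩
      rw [dReal, (hder y hy).mfderiv]
      exact (neg_pos.2 (h1 X hX)).le)
    have hloc : IsLocalMin ((ℓ ∘ extChartAt (𝓡 4) (ι q)) ∘ ι) q := by
      filter_upwards [hι.continuousAt.eventually hle, hmin] with q' h1 h2 using h1 h2
    have h0 := hder _ (mem_chart_source E4 (ι q))
    have h1 := dReal_mfderiv h0.mdifferentiableAt hι Y
    rw [hloc.mfderiv_eq_zero, dReal, h0.mfderiv, mfderiv_extChartAt_self] at h1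
    have h2 : -(g.val (ι q) W (mfderiv (𝓡 2) (𝓡 4) ι q Y)) = 0 := h1
    linarith
  obtain ⟨Y, hY⟩ : ∃ Y : TangentSpace (𝓡 2) q, Y ≠ 0 :=
    exists_ne (0 : EuclideanSpace ℝ (Fin 2))
  set T := τ.vec (ι q)
  set e := mfderiv (𝓡 2) (𝓡 4) ι q Y
  have hT : g.val (ι q) T T < 0 := τ.timelike (ι q)
  have he : 0 < g.val (ι q) e e := hsp Y hY
  have hTe : g.val (ι q) T e = 0 := key T hT hT Y
  have heT : g.val (ι q) e T = 0 := by rw [g.symm, hTe]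
  -- tilt the time direction slightly towards the surface
  obtain ⟨δ, hδ, hδ'⟩ : ∃ δ : ℝ, 0 < δ ∧ δ ^ 2 * g.val (ι q) e e < - g.val (ι q) T T := by
    have ht : Filter.Tendsto (fun δ : ℝ ↦ δ ^ 2 * g.val (ι q) e e) (𝓝[>] 0) (𝓝 0) := by
      have : Continuous fun δ : ℝ ↦ δ ^ 2 * g.val (ι q) e e := by fun_prop
      exact (this.tendsto' 0 0 (by simp)).mono_left nhdsWithin_le_nhds
    have h1 := (ht.eventually (gt_mem_nhds (neg_pos.2 hT))).and self_mem_nhdsWithin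
    obtain ⟨δ, h2, h3⟩ := h1.exists
    exact ⟨δ, h3, h2⟩
  have h := key (T + δ • e) (by
      simp only [map_add, map_smul, add_apply, smul_apply, smul_eq_mul, hTe, heT]
      nlinarith) (by simp only [map_add, map_smul, smul_eq_mul, hTe]; linarith) Y
  have h' : δ * g.val (ι q) e e = 0 := by
    have : g.val (ι q) (T + δ • e) e = δ * g.val (ι q) e e := by
      simp only [map_add, map_smul, add_apply, smul_apply, smul_eq_mul, hTe, zero_add]
    rw [← this]; exact h
  exact (mul_pos hδ he).ne' h'

end SphericallySymmetric

theorem mainTheorem9 {k : ℕ∞} (hk : 1 ≤ k)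
    {M : Type*} [TopologicalSpace M] [T2Space M] [SecondCountableTopology M] [ConnectedSpace M]
    [ChartedSpace E4 M] [IsManifold (𝓡 4) ∞ M]
    (g : LorentzMetric k M) (τ : TimeOrientation g) (D : SphericallySymmetric g τ)
    {N : Type*} [TopologicalSpace N] [ChartedSpace (EuclideanSpace ℝ (Fin 2)) N]
    [IsManifold (𝓡 2) 2 N] (ι : N → M) (hι : IsTrappedSurface g τ ι) :
    ¬ (range ι ⊆ {p : M | 0 ≤ D.du_r (D.u p, D.v p)}) ∧
    ¬ (range ι ⊆ {p : M | 0 ≤ D.dv_r (D.u p, D.v p)}) := by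
  have hcomp := hι.compact
  have hne := hι.nonempty
  have exists_min : ∀ w : M → ℝ, Continuous w → ∃ q, IsLocalMin (w ∘ ι) q := fun w hw ↦ by
    obtain ⟨q, -, hq⟩ := isCompact_univ.exists_isMinOn univ_nonempty
      (hw.comp hι.contMDiff.continuous).continuousOn
    exact ⟨q, hq.isLocalMin Filter.univ_mem⟩
  constructor
  · intro hA
    obtain ⟨q, hq⟩ := exists_min D.v D.continuous_v
    have hr : 0 ≤ D.du_r (D.u (ι q), D.v (ι q)) := hA (mem_range_self q)
    have hax : (D.u (ι q), D.v (ι q)) ∉ D.axis := fun h ↦ absurd hr (not_le.2 (D.du_r_axis _ h))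
    obtain ⟨X, hXu, hXv, hXn⟩ := D.exists_lift hk hax (1, 0)
    refine hι.not_isLocalMin (D.doubleNullAt hk hax).swap hXv hXu hXn
      (D.future_u _ hax X hXu hXv hXn) ?_ (D.OmegaSq_pos _ (D.mem_Q _)).le hq
    rw [D.dReal_r_sq hk hax, hXu, hXv]
    exact mul_nonneg (mul_nonneg zero_le_two (D.r_pos _ ⟨D.mem_Q _, hax⟩).le) hr
  · intro hB
    obtain ⟨q, hq⟩ := exists_min D.u D.continuous_u
    have hr : 0 ≤ D.dv_r (D.u (ι q), D.v (ι q)) := hB (mem_range_self q)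
    have hax : (D.u (ι q), D.v (ι q)) ∉ D.axis := fun h ↦ D.not_isLocalMin_of_mem_axis hk
      (hι.contMDiff.mdifferentiableAt (by norm_num)) (hι.spacelike q) h hq
    obtain ⟨X, hXu, hXv, hXn⟩ := D.exists_lift hk hax (0, 1)
    refine hι.not_isLocalMin (D.doubleNullAt hk hax) hXu hXv hXn
      (D.future_v _ hax X hXu hXv hXn) ?_ (D.OmegaSq_pos _ (D.mem_Q _)).le hq
    rw [D.dReal_r_sq hk hax, hXu, hXv]
    exact mul_nonneg (mul_nonneg zero_le_two (D.r_pos _ ⟨D.mem_Q _, hax⟩).le) hr
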